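/- **Setting.** Let $N$ be a finite ground set with $n$ elements and $f:2^{N}\to\mathbb{R}_{\ge 0}$ a monotone submodular function. Write $f(X\mid S)=f(X\cup S)-f(S)$ and $f(x)=f(\{x\})$. For a real $p\ge 1$, $f$ is *$p$-superseparable* if $\sum_{x\in N} f(x\mid S)\ \ge\ \sum_{x\in N} f(x)-p\,f(S)$ for all $S\subseteq N$. Let $k\ge 1$ be an integer and $\mathrm{OPT}=\max\{f(O): O\subseteq N,\ |O|\le k\}$. An algorithm accesses $f$ through a value oracle: in each adaptive round it submits a finite set of queries $S\subseteq N$ and receives all the values $f(S)$; its adaptivity is the number of rounds, its query count the total number of queries. **The procedure LinearAdaptiveSeq$(f,Q,k,\varepsilon)$** (the low-adaptivity variant of LinearSeq). Put $\beta=\varepsilon/\bigl(16\ln(8/(1-e^{-\varepsilon/2}))\bigr)$ and $\ell=\max\{0,\lceil 4(1+\frac1{\beta\varepsilon})\ln(|Q|/k)\rceil\}$. Query all singletons of $Q$; start with $A=(a)$, where $a\in Q$ maximizes $f(a)$ ($A$ is empty if $Q=\varnothing$), and $U=Q$. Repeat at most $\ell$ times: 1. (one round) Replace $U$ by $\{x\in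 U\setminus A: f(x\mid A)\ge f(A)/k\}$. If now $|U|\le k$, leave the loop. 2. Let $v_1,\dots,v_s$ be a uniformly random ordering of $U$ and $T_l=\{v_1,\dots,v_l\}$. Let $\lambda_0=0$ and $\lambda_{i+1}=\min\{s,\lambda_i+\max(1,\lfloor\varepsilon\min(\lambda_i,k)\rfloor)\}$. (One round) query all sets $A\cup T_{\lambda_i}$. Call the block from $\lambda_i$ to $\lambda_{i+1}$ good if $f(A\cup T_{\lambda_{i+1}})-f(A\cup T_{\lambda_i})\ge(\lambda_{i+1}-\lambda_i)(1-\varepsilon)f(A\cup T_{\lambda_i})/k$. 3. Let $e$ be the largest $\lambda_i$ such that every block $j<i$ with $\lambda_{j+1}>\lambda_i-k$ is good. Append $v_1,\dots,v_{\lambda^*}$ to $A$, where $\lambda^*=\min\{s,\,e+\lfloor\varepsilon\min(e,k)\rfloor\}$. If the loop has ended with $|U|>k$, report failure. Otherwise let $A'$ be the set of the last $k$ elements added to $A$ (all of $A$ if $|A|\le k$), query $f(A')$ and $f(U)$ in one round, and return the better of $A'$ and $U$. **Theorem.** There is an absolute constant $C>0$ such that the following holds. Let $f$ be non-negative, monotone,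 submodular and $p$-superseparable with $p\ge1$, let $k\ge1$, $0<\alpha<1$ and $0<\varepsilon<\frac12$, and let $Q\subseteq N$ be a set of top-$m$ elements by singleton value $f(x)$, where $m=\lceil\frac{pk}{1-\alpha}+k\rceil$ ($Q=N$ if $n\le m$; ties broken arbitrarily). Run LinearAdaptiveSeq$(f,Q,k,\varepsilon)$. Then: * with probability at least $1-C\max\{\frac{1-\alpha}{p},\frac kn\}$ it returns a set $S$ with $|S|\le k$ and $$f(S)\ \ge\ \alpha\left(5+\frac{4(2-\varepsilon)\varepsilon}{(1-\varepsilon)(1-2\varepsilon)}\right)^{-1}\mathrm{OPT};$$ in particular this probability is $1-O(\frac{1-\alpha}{p})$ whenever $n\ge\frac{pk}{1-\alpha}$; * it always uses at most $\frac{C}{\varepsilon^{3}}\bigl(1+\ln\frac{p}{1-\alpha}\bigr)$ adaptive rounds; * its expected number of queries is at most $\frac{C}{1-\alpha}\left(\frac{pk}{\varepsilon^3}+\frac{p}{\varepsilon^4}\right)$. (The single round of $n$ singleton queries that determines $Q$ is not counted.) -/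

import Mathlib

noncomputable section

open scoped ENNReal

/-! ### Set functions -/

/-- Marginal gain `f(X ∣ S) = f(X ∪ S) - f(S)`. -/
def marginalGain {V : Type*} [DecidableEq V] (f : Finset V → ℝ) (X S : Finset V) : ℝ :=
  f (X ∪ S) - f S

/-- Diminishing marginal gains. -/
def IsSubmodularFn {V : Type*} [DecidableEq V] (f : Finset V → ℝ) : Prop :=
  ∀ S T : Finset V, S ⊆ T → ∀ x, x ∉ T → marginalGain f {x} T ≤ marginalGain f {x} S

/-- `p`-superseparability: `∑ₓ f(x ∣ S) ≥ ∑ₓ f(x) - p f(S)` for every set `S`. -/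
def IsSuperseparable {V : Type*} [Fintype V] [DecidableEq V] (f : Finset V → ℝ) (p : ℝ) : Prop :=
  ∀ S : Finset V, (∑ x, f {x}) - p * f S ≤ ∑ x, marginalGain f {x} S

/-- `Q` is a set of top-`m` elements by singleton value (all elements, if there are fewer than `m`);
ties may be broken in any way. -/
def IsTopSet {V : Type*} [Fintype V] (f : Finset V → ℝ) (m : ℕ) (Q : Finset V) : Prop :=
  Q.card = min m (Fintype.card V) ∧ ∀ x ∈ Q, ∀ y, y ∉ Q → f {y} ≤ f {x}

/-! ### Randomized algorithms in the adaptive query model -/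

/-- A randomized algorithm with access to a value oracle on subsets of `V` and output in `R`:
it stops with an output, or draws a uniformly random ordering of a finite set, or performs one
adaptive round, in which it submits a finite set of queries and goes on with the answers. -/
inductive AdaptiveAlg (V : Type*) (R : Type*) where
  | ret : R → AdaptiveAlg V R
  | shuffle : Finset V → (List V → AdaptiveAlg V R) → AdaptiveAlg V R
  | round : Finset (Finset V) → ((Finset V → ℝ) → AdaptiveAlg V R) → AdaptiveAlg V R

/-- What a run produces: the output, the number of adaptive rounds, the number of queries. -/
structure RunOutcome (R : Type*) where
  output : R
  rounds : ℕ
  queries : ℕ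

/-- A uniformly random ordering of the elements of `U`. -/
def randomOrdering {V : Type*} [DecidableEq V] (U : Finset V) : PMF (List V) :=
  PMF.uniformOfFinset U.toList.permutations.toFinset ⟨U.toList, by simp⟩

/-- The law of a run of an algorithm with value oracle `f`. In a round with query set `qs`, the
algorithm learns `f` on `qs` only (other arguments are answered by `0`); it is charged one
adaptive round and as many queries as `qs` has elements. -/
def AdaptiveAlg.run {V R : Type*} [DecidableEq V] (f : Finset V → ℝ) :
    AdaptiveAlg V R → PMF (RunOutcome R)
  | .ret r => PMF.pure ⟨r, 0, 0⟩
  | .shuffle U next => (randomOrdering U).bind fun v => (next v).run f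
  | .round qs next =>
      ((next fun S => if S ∈ qs then f S else 0).run f).map
        fun x => ⟨x.output, x.rounds + 1, x.queries + qs.card⟩

/-- Expected number of queries. -/
def expectedQueries {R : Type*} (P : PMF (RunOutcome R)) : ℝ≥0∞ :=
  ∑' x, P x * (x.queries : ℝ≥0∞)

/-! ### The low-adaptivity linear-sequence procedure -/

/-- Candidate prefix lengths `λ₀ = 0`, `λᵢ₊₁ = min (s, λᵢ + max (1, ⌊ε min (λᵢ, k)⌋))` for an
ordering of `s` elements: geometric with ratio `1 + ε` up to `k`, arithmetic with step `ε k`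
beyond `k`, up to rounding. The last one, `s`, is reached after at most `s` steps. -/
def prefixLen (ε : ℝ) (k s : ℕ) : ℕ → ℕ
  | 0 => 0
  | i + 1 => min s (prefixLen ε k s i + max 1 ⌊ε * (min (prefixLen ε k s i) k : ℕ)⌋₊)

/-- The set `A ∪ {v₁, …, v_l}`. -/
def extendBy {V : Type*} [DecidableEq V] (A v : List V) (l : ℕ) : Finset V :=
  (A ++ v.take l).toFinset

/-- The sets `A ∪ {v₁, …, v_{λᵢ}}` for all candidate prefix lengths `λᵢ` of the ordering `v`. -/
def prefixQueries {V : Type*} [DecidableEq V] (ε : ℝ) (k : ℕ) (A v : List V) :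
    Finset (Finset V) :=
  (Finset.range (v.length + 1)).image fun i => extendBy A v (prefixLen ε k v.length i)

/-- The block `v_{λᵢ+1}, …, v_{λᵢ₊₁}` is good: its average marginal gain to
`A ∪ {v₁, …, v_{λᵢ}}` is at least `(1 - ε) f(A ∪ {v₁, …, v_{λᵢ}}) / k`. -/
def BlockGood {V : Type*} [DecidableEq V] (f : Finset V → ℝ) (ε : ℝ) (k : ℕ) (A v : List V)
    (i : ℕ) : Prop :=
  ((prefixLen ε k v.length (i + 1) : ℝ) - prefixLen ε k v.length i) *
      ((1 - ε) * f (extendBy A v (prefixLen ε k v.length i)) / k) ≤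
    f (extendBy A v (prefixLen ε k v.length (i + 1))) -
      f (extendBy A v (prefixLen ε k v.length i))

/-- The prefix of length `λᵢ` ends in a run of good blocks that covers its last `min (λᵢ, k)`
elements. -/
def EndsInGoodRun {V : Type*} [DecidableEq V] (f : Finset V → ℝ) (ε : ℝ) (k : ℕ) (A v : List V)
    (i : ℕ) : Prop :=
  ∀ j < i, prefixLen ε k v.length i < prefixLen ε k v.length (j + 1) + k →
    BlockGood f ε k A v j

open Classical in
/-- The length `λ*` of the prefix that is added: take the largest candidate length `e` whose prefix
ends in a good run (so that the next block, if any, is not good), and add the next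
`⌊ε min (e, k)⌋` elements, which is that next block unless `ε min (e, k) < 1`. -/
def chosenLen {V : Type*} [DecidableEq V] (f : Finset V → ℝ) (ε : ℝ) (k : ℕ)
    (A v : List V) : ℕ :=
  let e := prefixLen ε k v.length (Nat.findGreatest (EndsInGoodRun f ε k A v) v.length)
  min v.length (e + ⌊ε * (min e k : ℕ)⌋₊)

/-- The elements of `U` outside `A` whose marginal gain to `A` is at least `f(A) / k`. -/
def filterSet {V : Type*} [DecidableEq V] (f : Finset V → ℝ) (k : ℕ) (A : List V)
    (U : Finset V) : Finset V :=
  U.filter fun x => x ∉ A ∧ f A.toFinset / k ≤ marginalGain f {x} A.toFinset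

/-- Return the better of the last `k` elements of `A` and the set `U` (one round). -/
def returnBest {V : Type*} [DecidableEq V] (k : ℕ) (A : List V) (U : Finset V) :
    AdaptiveAlg V (Option (Finset V)) :=
  let A' := (A.drop (A.length - k)).toFinset
  .round {A', U} fun f => .ret (some (if f U ≤ f A' then A' else U))

/-- The main loop, with current solution `A` (in order of insertion), current candidates `U` and at
most the given number of further iterations. The output `none` is the report of a failure. -/
def lowAdapLoop {V : Type*} [DecidableEq V] (k : ℕ) (ε : ℝ) :
    ℕ → List V → Finset V → AdaptiveAlg V (Option (Finset V))
  | 0, A, U => if U.card ≤ k then returnBest k A U else .ret none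
  | n + 1, A, U =>
      .round (insert A.toFinset (U.image fun x => {x} ∪ A.toFinset)) fun f =>
        if (filterSet f k A U).card ≤ k then
          returnBest k A (filterSet f k A U)
        else
          .shuffle (filterSet f k A U) fun v =>
            .round (prefixQueries ε k A v) fun g =>
              lowAdapLoop k ε n (A ++ v.take (chosenLen g ε k A v)) (filterSet f k A U)

/-- The parameter `β = ε / (16 log (8 / (1 - e^{-ε/2})))`. -/
def lasBeta (ε : ℝ) : ℝ := ε / (16 * Real.log (8 / (1 - Real.exp (-ε / 2))))

/-- The number of iterations `⌈4 (1 + 1/(βε)) log (n/k)⌉` (none if `n ≤ k`). -/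
def lasIterations (n k : ℕ) (ε : ℝ) : ℕ :=
  ⌈4 * (1 + 1 / (lasBeta ε * ε)) * Real.log ((n : ℝ) / k)⌉₊

/-- The low-adaptivity linear-sequence procedure on the elements of `Q`: one round that finds an
element of largest value, and then the loop. -/
def lowAdapLinearSeq {V : Type*} [DecidableEq V] (Q : Finset V) (k : ℕ) (ε : ℝ) :
    AdaptiveAlg V (Option (Finset V)) :=
  .round (Q.image fun x => {x}) fun f =>
    lowAdapLoop k ε (lasIterations Q.card k ε) (Q.toList.argmax fun x => f {x}).toList Q

end

/-! Three independent arguments carry the theorem.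

Reduction to `Q`. By superseparability and averaging, for every `S` with at most `k` elements some
`x ∈ Q \ S` has `f(x ∣ S) ≥ f(x) - (1-α) f(S)/k`. Exchanging the elements of `O \ Q` for such
elements one by one gives `S ⊆ Q` with `f(O) ≤ (2-α) f(S)`, and `α(2-α) ≤ 1`
(`exists_subset_topSet`).

Approximation inside `Q`. An element that was filtered out gains at most `f(A)/k`, so `f(O) ≤ f(U) +
2 f(A)`. Whatever is appended to `A` consists of good blocks except for a fraction of order `ε`;
hence the last `k` elements multiply the value by nearly 2, and by submodularity `A'` alone has
about half of `f(A)` (`WindowGain.append`, `WindowGain.le_value_drop`, `LoopInvariant.approx`).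

Contraction. Put `γ = βε`. As long as a prefix of the random ordering rules out fewer than `γ|U|`
candidates, the next element is ruled out with conditional probability at most `γ`, so the number of
bad elements in a block has the exponential moments of independent trials (`sum_pow_eventCount_le`).
A block with at most a fraction `ε` of bad elements is good. The union bound over blocks does not
depend on `|U|`: good blocks multiply the value by `e^{2l/(5k)}` after `l` elements, whereas a
surviving candidate `x` forces `f(A ∪ T_l) ≤ k f(x) ≤ k f(A)`, so only blocks starting at `l ≤ (5/2)
k ln k` matter. Their failure probabilities add up to at most `1/2` (`sum_blockTail_le`); this is
what the logarithm in `β` pays for. Otherwise the run of good blocks reaches the point where `γ|U|`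
candidates are ruled out, so one iteration shrinks `U` by the factor `1 - γ/2` in expectation
(`sum_card_filterSet_le`).

Markov's inequality after all iterations bounds the failure probability by `2k/|Q|`, and a geometric
series bounds the expected number of queries. The number of rounds is of the order of the number of
iterations, with `1/γ ≤ 512/ε³`. -/

/-! ### Uniformly random orderings -/

noncomputable section Orderings

variable {V : Type*}

/-- The `i`-th element of `v` is related by `B` to the elements before it. -/
def EventAt (B : List V → V → Prop) (v : List V) (i : ℕ) : Prop :=
  ∃ x, v[i]? = some x ∧ B (v.take i) x

theorem eventAt_cons_zero {B : List V → V → Prop} {x : V} {v : List V} :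
    EventAt B (x :: v) 0 ↔ B [] x := by
  simp [EventAt]

theorem eventAt_cons_succ {B : List V → V → Prop} {x : V} {v : List V} {i : ℕ} :
    EventAt B (x :: v) (i + 1) ↔ EventAt (fun w => B (x :: w)) v i := by
  simp [EventAt]

theorem EventAt.lt_length {B : List V → V → Prop} {v : List V} {i : ℕ} (h : EventAt B v i) :
    i < v.length := by
  obtain ⟨x, hx, -⟩ := h
  exact (List.getElem?_eq_some_iff.mp hx).1

open Classical in
/-- The number of indices in `J` at which the event happens. -/
def eventCount (B : List V → V → Prop) (J : Finset ℕ) (v : List V) : ℕ :=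
  (J.filter (EventAt B v)).card

variable [DecidableEq V]

/-- The orderings of the elements of `U`. -/
def orderings (U : Finset V) : Finset (List V) := U.toList.permutations.toFinset

theorem mem_orderings {U : Finset V} {v : List V} :
    v ∈ orderings U ↔ v.Nodup ∧ v.toFinset = U := by
  rw [orderings, List.mem_toFinset, List.mem_permutations]
  constructor
  · intro h
    exact ⟨h.nodup_iff.mpr U.nodup_toList, by rw [List.toFinset_eq_of_perm _ _ h]; simp⟩
  · rintro ⟨h1, rfl⟩
    rw [List.perm_ext_iff_of_nodup h1 (Finset.nodup_toList _)]
    simp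

theorem card_orderings (U : Finset V) : (orderings U).card = U.card.factorial := by
  rw [orderings, List.toFinset_card_of_nodup (List.nodup_permutations _ U.nodup_toList),
    List.length_permutations, Finset.length_toList]

theorem length_of_mem_orderings {U : Finset V} {v : List V} (h : v ∈ orderings U) :
    v.length = U.card := by
  obtain ⟨h1, rfl⟩ := mem_orderings.mp h
  rw [List.toFinset_card_of_nodup h1]

theorem cons_mem_orderings {U : Finset V} {x : V} {v : List V} :
    x :: v ∈ orderings U ↔ x ∈ U ∧ v ∈ orderings (U.erase x) := by
  simp only [mem_orderings, List.nodup_cons, List.toFinset_cons]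
  constructor
  · rintro ⟨⟨h1, h2⟩, rfl⟩
    refine ⟨by simp, h2, ?_⟩
    rw [Finset.erase_insert]
    simpa using h1
  · rintro ⟨h1, h2, h3⟩
    refine ⟨⟨?_, h2⟩, ?_⟩
    · rw [← List.mem_toFinset, h3]; simp
    · rw [h3, Finset.insert_erase h1]

/-- An ordering is a first element followed by an ordering of the remaining elements. -/
theorem sum_orderings_cons {M : Type*} [AddCommMonoid M] {U : Finset V} (hU : U.Nonempty)
    (g : List V → M) :
    ∑ v ∈ orderings U, g v = ∑ x ∈ U, ∑ v ∈ orderings (U.erase x), g (x :: v) := by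
  rw [Finset.sum_sigma']
  symm
  refine Finset.sum_bij (fun a _ => a.1 :: a.2) ?_ ?_ ?_ ?_
  · rintro ⟨x, v⟩ h
    rw [Finset.mem_sigma] at h
    exact cons_mem_orderings.mpr h
  · rintro ⟨x, v⟩ _ ⟨y, w⟩ _ h
    simp only [List.cons.injEq] at h
    obtain ⟨rfl, rfl⟩ := h
    rfl
  · intro v hv
    cases v with
    | nil =>
      have := (mem_orderings.mp hv).2
      simp only [List.toFinset_nil] at this
      exact absurd this.symm hU.ne_empty
    | cons x v =>
      exact ⟨⟨x, v⟩, by rw [Finset.mem_sigma]; exact cons_mem_orderings.mp hv, rfl⟩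
  · intros; rfl

open Classical in
/-- In a random ordering, the next element is related by `B` to those before it with conditional
probability at most `γ`. -/
def CondProbLE (B : List V → V → Prop) (U : Finset V) (γ : ℝ) : Prop :=
  ∀ w : List V, w.Nodup → w.toFinset ⊆ U →
    (((U \ w.toFinset).filter (B w)).card : ℝ) ≤ γ * ((U.card : ℝ) - w.length)

-- Induction on the ordering, revealing its first element: given the past, each index in `J`
-- contributes an expected factor of at most `1 + γ(z-1)`. No independence is needed.
open Classical in
theorem sum_prod_eventAt_le (γ z : ℝ) (hz : 1 ≤ z) (hγ : 0 ≤ γ) :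
    ∀ (n : ℕ) (U : Finset V), U.card = n → ∀ (B : List V → V → Prop) (J : ℕ → Prop),
      CondProbLE B U γ →
      ∑ v ∈ orderings U, ∏ i ∈ Finset.range n, (if J i ∧ EventAt B v i then z else 1) ≤
        n.factorial * ∏ i ∈ Finset.range n, (if J i then 1 + γ * (z - 1) else 1) := by
  intro n
  induction n with
  | zero =>
    intro U hU B J _
    simp [card_orderings, hU]
  | succ n ih =>
    intro U hU B J hB
    have hne : U.Nonempty := by rw [← Finset.card_pos]; omega
    rw [sum_orderings_cons hne]
    set P : ℝ := ∏ i ∈ Finset.range n, (if J (i + 1) then 1 + γ * (z - 1) else 1) with hP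
    have hz' : 0 ≤ γ * (z - 1) := mul_nonneg hγ (by linarith)
    have hP0 : 0 ≤ P := Finset.prod_nonneg fun i _ => by split_ifs <;> linarith
    -- Fix the first element `x`. The hypothesis passes to `B (x :: ·)` on `U.erase x`, because
    -- `|U|` and the length of the history both change by one.
    have key : ∀ x ∈ U, ∑ v ∈ orderings (U.erase x),
        ∏ i ∈ Finset.range (n + 1), (if J i ∧ EventAt B (x :: v) i then z else 1) ≤
        (n.factorial * P) * (if J 0 ∧ B [] x then z else 1) := by
      intro x hx
      have hc : (U.erase x).card = n := by rw [Finset.card_erase_of_mem hx, hU]; rfl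
      have := ih (U.erase x) hc (fun w => B (x :: w)) (fun i => J (i + 1)) (by
        intro w hw hwU
        have hxw : x ∉ w := fun h => by
          have := hwU (List.mem_toFinset.mpr h)
          simp at this
        have h := hB (x :: w) (List.nodup_cons.mpr ⟨hxw, hw⟩) (by
          intro y hy
          simp only [List.toFinset_cons, Finset.mem_insert] at hy
          rcases hy with rfl | hy
          · exact hx
          · exact Finset.mem_of_mem_erase (hwU hy))
        have he : U \ (x :: w).toFinset = U.erase x \ w.toFinset := by
          ext y; simp only [List.toFinset_cons, Finset.mem_sdiff, Finset.mem_insert,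
            Finset.mem_erase]; tauto
        rw [he] at h
        refine h.trans (le_of_eq ?_)
        rw [hc, hU, List.length_cons]; push_cast; ring)
      simp only [Finset.prod_range_succ', eventAt_cons_zero, eventAt_cons_succ]
      rw [← Finset.sum_mul]
      refine mul_le_mul_of_nonneg_right this ?_
      split_ifs <;> linarith
    refine (Finset.sum_le_sum key).trans ?_
    rw [← Finset.mul_sum, Finset.prod_range_succ', ← hP]
    have hsum : ∑ x ∈ U, (if J 0 ∧ B [] x then z else 1 : ℝ) ≤
        (n + 1) * (if J 0 then 1 + γ * (z - 1) else 1) := by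
      by_cases hJ : J 0
      · have h := hB [] List.nodup_nil (by simp)
        simp only [List.toFinset_nil, Finset.sdiff_empty, List.length_nil, hU] at h
        have e : ∀ x, (if J 0 ∧ B [] x then z else 1 : ℝ) = 1 + (z - 1) * (if B [] x then 1 else 0) := by
          intro x; simp only [hJ, true_and]; split_ifs <;> ring
        simp only [e, Finset.sum_add_distrib, ← Finset.mul_sum, Finset.sum_boole, if_pos hJ]
        simp only [Finset.sum_const, hU, nsmul_eq_mul]
        push_cast at h ⊢
        nlinarith
      · simp [hJ, hU]
    calc _ ≤ (n.factorial * P) * ((n + 1) * (if J 0 then 1 + γ * (z - 1) else 1)) :=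
          mul_le_mul_of_nonneg_left hsum (by positivity)
      _ = _ := by rw [Nat.factorial_succ]; push_cast; ring

/-- Exponential moments of the number of events are bounded as for independent events. -/
theorem sum_pow_eventCount_le {γ z : ℝ} (hz : 1 ≤ z) (hγ : 0 ≤ γ) {U : Finset V}
    {B : List V → V → Prop} (hB : CondProbLE B U γ) (J : Finset ℕ) :
    ∑ v ∈ orderings U, z ^ eventCount B J v ≤
      U.card.factorial * (1 + γ * (z - 1)) ^ J.card := by
  classical
  have hz' : 0 ≤ γ * (z - 1) := mul_nonneg hγ (by linarith)
  have h : ∑ v ∈ orderings U, ∏ i ∈ Finset.range U.card,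
      (if i ∈ J ∧ EventAt B v i then z else 1) ≤
      U.card.factorial * ∏ i ∈ Finset.range U.card, (if i ∈ J then 1 + γ * (z - 1) else 1) := by
    convert sum_prod_eventAt_le γ z hz hγ U.card U rfl B (· ∈ J) hB
  calc _ = _ := by
        refine Finset.sum_congr rfl fun v hv => ?_
        refine Eq.trans ?_ (Finset.prod_ite (fun _ => z) (fun _ => 1)).symm
        rw [Finset.prod_const, Finset.prod_const_one, mul_one, eventCount]
        congr 2
        ext i
        simp only [Finset.mem_filter, Finset.mem_range]
        constructor
        · rintro ⟨h1, h2⟩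
          exact ⟨by rw [← length_of_mem_orderings hv]; exact h2.lt_length, h1, h2⟩
        · tauto
    _ ≤ _ := h
    _ ≤ _ := by
        refine mul_le_mul_of_nonneg_left ?_ (by positivity)
        refine (Finset.prod_ite (fun _ => 1 + γ * (z - 1)) (fun _ => 1)).trans_le ?_
        rw [Finset.prod_const, Finset.prod_const_one, mul_one]
        refine pow_le_pow_right₀ (by linarith) (Finset.card_le_card fun i => ?_)
        simp

open Classical in
/-- Union bound. -/
theorem card_one_le_eventCount_le {γ : ℝ} (hγ : 0 ≤ γ) {U : Finset V}
    {B : List V → V → Prop} (hB : CondProbLE B U γ) (J : Finset ℕ) :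
    (((orderings U).filter fun v => 1 ≤ eventCount B J v).card : ℝ) ≤
      U.card.factorial * (γ * J.card) := by
  have h1 : ∀ i, (((orderings U).filter fun v => EventAt B v i).card : ℝ) ≤
      U.card.factorial * γ := by
    intro i
    -- For a single index and `z = 2` the moment is one plus the probability of the event.
    have h := sum_pow_eventCount_le (z := 2) (by norm_num) hγ hB {i}
    have e : ∀ v, (2 : ℝ) ^ eventCount B {i} v = 1 + if EventAt B v i then 1 else 0 := by
      intro v
      rw [eventCount, Finset.filter_singleton]
      split_ifs <;> norm_num
    simp only [e, Finset.sum_add_distrib, Finset.sum_boole, Finset.sum_const, card_orderings,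
      nsmul_eq_mul, Finset.card_singleton] at h
    nlinarith
  have h2 : ((orderings U).filter fun v => 1 ≤ eventCount B J v) ⊆
      J.biUnion fun i => (orderings U).filter fun v => EventAt B v i := by
    intro v hv
    simp only [Finset.mem_filter, eventCount, Nat.one_le_iff_ne_zero, Finset.card_ne_zero] at hv
    obtain ⟨hv, i, hi⟩ := hv
    simp only [Finset.mem_filter] at hi
    simp only [Finset.mem_biUnion, Finset.mem_filter]
    exact ⟨i, hi.1, hv, hi.2⟩
  have h3 := (Finset.card_le_card h2).trans Finset.card_biUnion_le
  calc _ ≤ ((∑ i ∈ J, ((orderings U).filter fun v => EventAt B v i).card : ℕ) : ℝ) := by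
        exact_mod_cast h3
    _ ≤ ∑ i ∈ J, (U.card.factorial * γ : ℝ) := by
        push_cast; exact Finset.sum_le_sum fun i _ => h1 i
    _ = _ := by rw [Finset.sum_const, nsmul_eq_mul]; ring

/-- Exponential tail bound. -/
theorem card_le_eventCount_le {γ z : ℝ} (hz : 1 ≤ z) (hγ : 0 ≤ γ) {U : Finset V}
    {B : List V → V → Prop} (hB : CondProbLE B U γ) (J : Finset ℕ) (r : ℕ) :
    (((orderings U).filter fun v => r ≤ eventCount B J v).card : ℝ) ≤
      U.card.factorial * ((1 / z) ^ r * Real.exp (γ * z * J.card)) := by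
  have h := sum_pow_eventCount_le hz hγ hB J
  have hz0 : 0 < z := by linarith
  have h1 : (((orderings U).filter fun v => r ≤ eventCount B J v).card : ℝ) * z ^ r ≤
      ∑ v ∈ orderings U, z ^ eventCount B J v := by
    rw [← nsmul_eq_mul, ← Finset.sum_const]
    calc _ ≤ ∑ v ∈ (orderings U).filter fun v => r ≤ eventCount B J v, z ^ eventCount B J v := by
          refine Finset.sum_le_sum fun v hv => ?_
          exact pow_le_pow_right₀ hz (Finset.mem_filter.mp hv).2
      _ ≤ _ := Finset.sum_le_sum_of_subset_of_nonneg (Finset.filter_subset _ _)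
          fun v _ _ => by positivity
  have h2 : (1 + γ * (z - 1)) ^ J.card ≤ Real.exp (γ * z * J.card) := by
    have : 0 ≤ γ * (z - 1) := mul_nonneg hγ (by linarith)
    rw [mul_comm (γ * z), Real.exp_nat_mul]
    refine pow_le_pow_left₀ (by linarith) ?_ _
    have := Real.add_one_le_exp (γ * z)
    nlinarith
  have h3 : (((orderings U).filter fun v => r ≤ eventCount B J v).card : ℝ) * z ^ r ≤
      U.card.factorial * Real.exp (γ * z * J.card) :=
    h1.trans (h.trans (mul_le_mul_of_nonneg_left h2 (by positivity)))
  have h4 : (1 / z) ^ r * z ^ r = 1 := by rw [← mul_pow, one_div_mul_cancel hz0.ne', one_pow]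
  have h5 : 0 < z ^ r := by positivity
  refine le_of_mul_le_mul_right ?_ h5
  calc _ ≤ _ := h3
    _ = U.card.factorial * (((1 / z) ^ r * z ^ r) * Real.exp (γ * z * J.card)) := by
        rw [h4, one_mul]
    _ = _ := by ring

end Orderings

/-! ### Prefix lengths -/

noncomputable section PrefixLengths

/-- The length of the block that starts after a prefix of length `l`. -/
def blockSize (ε : ℝ) (k l : ℕ) : ℕ := max 1 ⌊ε * (min l k : ℕ)⌋₊

/-- The candidate prefix lengths of an infinite ordering. -/
def prefixLenInf (ε : ℝ) (k : ℕ) : ℕ → ℕ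
  | 0 => 0
  | i + 1 => prefixLenInf ε k i + blockSize ε k (prefixLenInf ε k i)

theorem one_le_blockSize (ε : ℝ) (k l : ℕ) : 1 ≤ blockSize ε k l := le_max_left _ _

/-- Truncation at `s` can be postponed to the end, so block sizes can be studied without reference
to the length of the ordering. -/
theorem prefixLen_eq_min (ε : ℝ) (k s i : ℕ) :
    prefixLen ε k s i = min s (prefixLenInf ε k i) := by
  induction i with
  | zero => simp [prefixLen, prefixLenInf]
  | succ i ih =>
    rw [prefixLen, prefixLenInf, ← blockSize]
    rcases le_total s (prefixLenInf ε k i) with h | h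
    · rw [ih, min_eq_left h]; omega
    · rw [ih, min_eq_right h]

theorem le_prefixLenInf (ε : ℝ) (k i : ℕ) : i ≤ prefixLenInf ε k i := by
  induction i with
  | zero => simp
  | succ i ih =>
    have := one_le_blockSize ε k (prefixLenInf ε k i)
    rw [prefixLenInf]; omega

theorem prefixLenInf_strictMono (ε : ℝ) (k : ℕ) : StrictMono (prefixLenInf ε k) :=
  strictMono_nat_of_lt_succ fun i => by
    have := one_le_blockSize ε k (prefixLenInf ε k i)
    rw [prefixLenInf]; omega

theorem prefixLen_mono (ε : ℝ) (k s : ℕ) : Monotone (prefixLen ε k s) := by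
  intro i j h
  rw [prefixLen_eq_min, prefixLen_eq_min]
  exact min_le_min le_rfl ((prefixLenInf_strictMono ε k).monotone h)

theorem prefixLen_le (ε : ℝ) (k s i : ℕ) : prefixLen ε k s i ≤ s := by
  rw [prefixLen_eq_min]; exact min_le_left _ _

theorem prefixLen_self (ε : ℝ) (k s : ℕ) : prefixLen ε k s s = s := by
  rw [prefixLen_eq_min]; exact min_eq_left (le_prefixLenInf _ _ _)

theorem blockSize_le {ε : ℝ} (h0 : 0 ≤ ε) (k l : ℕ) : blockSize ε k l ≤ blockSize ε k k := by
  unfold blockSize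
  refine max_le_max le_rfl (Nat.floor_le_floor ?_)
  have : ((min l k : ℕ) : ℝ) ≤ ((min k k : ℕ) : ℝ) := by exact_mod_cast by simp
  gcongr

theorem blockSize_of_le {ε : ℝ} {k l : ℕ} (h : k ≤ l) : blockSize ε k l = blockSize ε k k := by
  simp [blockSize, h]

theorem blockSize_self_le {ε : ℝ} (h1 : ε ≤ 1) {k : ℕ} (hk : 1 ≤ k) :
    blockSize ε k k ≤ k := by
  unfold blockSize
  refine max_le hk ?_
  rw [min_self]
  refine (Nat.floor_le_floor (?_ : ε * (k : ℝ) ≤ (k : ℝ))).trans (Nat.floor_natCast k).le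
  have : (0 : ℝ) ≤ k := by positivity
  nlinarith

theorem blockSize_le_of_ne_one {ε : ℝ} (h0 : 0 ≤ ε) {k l : ℕ} (h : blockSize ε k l ≠ 1) :
    (blockSize ε k l : ℝ) ≤ ε * (min l k : ℕ) := by
  unfold blockSize at *
  rcases le_total 1 ⌊ε * ((min l k : ℕ) : ℝ)⌋₊ with h1 | h1
  · rw [max_eq_right h1]
    exact Nat.floor_le (by positivity)
  · rw [max_eq_left h1] at h; exact absurd rfl h

theorem lt_blockSize_add_one (ε : ℝ) (k l : ℕ) : ε * (min l k : ℕ) < blockSize ε k l + 1 := by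
  have h1 := Nat.lt_floor_add_one (ε * (min l k : ℕ) : ℝ)
  have h2 : ⌊ε * (min l k : ℕ)⌋₊ ≤ blockSize ε k l := le_max_right _ _
  have h3 : (⌊ε * (min l k : ℕ)⌋₊ : ℝ) ≤ blockSize ε k l := by exact_mod_cast h2
  linarith

/-- Blocks that start before `X` and have length at most `Y` cover at most `X + Y` elements. -/
theorem sum_blockSize_le (ε : ℝ) (k : ℕ) (P : ℕ → Prop) [DecidablePred P] {X Y : ℝ}
    (hXY : 0 ≤ X + Y)
    (hP : ∀ j, P j → (prefixLenInf ε k j : ℝ) ≤ X ∧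
      (blockSize ε k (prefixLenInf ε k j) : ℝ) ≤ Y) (n : ℕ) :
    ∑ j ∈ (Finset.range n).filter P, (blockSize ε k (prefixLenInf ε k j) : ℝ) ≤ X + Y := by
  -- The first bound in the minimum makes the induction work: the earlier blocks end where block `n`
  -- starts, which is at most `X` if block `n` is counted.
  suffices h : ∑ j ∈ (Finset.range n).filter P, (blockSize ε k (prefixLenInf ε k j) : ℝ) ≤
      min (prefixLenInf ε k n : ℝ) (X + Y) from h.trans (min_le_right _ _)
  induction n with
  | zero => simpa [prefixLenInf] using hXY
  | succ n ih =>
    rw [le_min_iff] at ih ⊢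
    rw [Finset.range_add_one, Finset.filter_insert, prefixLenInf]
    push_cast
    split_ifs with h
    · obtain ⟨h1, h2⟩ := hP n h
      rw [Finset.sum_insert (by simp)]
      constructor <;> linarith
    · exact ⟨ih.1.trans (by simp), ih.2⟩

/-! ### The parameter `β` -/

/-- Since `ε/4 ≤ 1 - e^{-ε/2} ≤ ε/2`, the argument of the logarithm lies between `16/ε` and `32/ε`.
The first bound beats `ln k` in the union bound; the last one gives `β ≥ ε²/512`. -/
theorem log_lasBeta_bounds {ε : ℝ} (h0 : 0 < ε) (h1 : ε < 1 / 2) :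
    Real.log (1 / ε) + 2 ≤ Real.log (8 / (1 - Real.exp (-ε / 2))) ∧
    3 ≤ Real.log (8 / (1 - Real.exp (-ε / 2))) ∧
    Real.log (8 / (1 - Real.exp (-ε / 2))) ≤ 32 / ε := by
  have hx : 1 - Real.exp (-ε / 2) ≤ ε / 2 := by
    have := Real.add_one_le_exp (-ε / 2); linarith
  have hy : ε / 4 ≤ 1 - Real.exp (-ε / 2) := by
    have h := Real.add_one_le_exp (ε / 2)
    have h2 : Real.exp (-ε / 2) * Real.exp (ε / 2) = 1 := by
      rw [← Real.exp_add]; ring_nf; exact Real.exp_zero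
    have h3 := Real.exp_pos (-ε / 2)
    nlinarith
  have hpos : 0 < 1 - Real.exp (-ε / 2) := by linarith
  have hge : 16 * (1 / ε) ≤ 8 / (1 - Real.exp (-ε / 2)) := by
    rw [le_div_iff₀ hpos]
    have : 16 * (1 / ε) * (ε / 2) = 8 := by field_simp; norm_num
    have h16 : (0 : ℝ) ≤ 16 * (1 / ε) := by positivity
    nlinarith [mul_le_mul_of_nonneg_left hx h16]
  have hle : 8 / (1 - Real.exp (-ε / 2)) ≤ 32 / ε := by
    rw [div_le_div_iff₀ hpos h0]; linarith
  have hlog := Real.log_le_log (by positivity) hge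
  have e16 : Real.log 16 = 4 * Real.log 2 := by
    rw [show (16 : ℝ) = 2 ^ 4 by norm_num, Real.log_pow]; norm_num
  have hlog2 := Real.log_two_gt_d9
  rw [Real.log_mul (by norm_num) (by positivity), e16] at hlog
  have hL : Real.log 2 ≤ Real.log (1 / ε) := by
    refine Real.log_le_log (by norm_num) ?_
    rw [le_div_iff₀ h0]; linarith
  refine ⟨by linarith, by linarith, ?_⟩
  have h8 := Real.log_le_sub_one_of_pos (show 0 < 8 / (1 - Real.exp (-ε / 2)) by positivity)
  linarith

theorem lasBeta_pos {ε : ℝ} (h0 : 0 < ε) (h1 : ε < 1 / 2) : 0 < lasBeta ε := by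
  obtain ⟨-, h, -⟩ := log_lasBeta_bounds h0 h1
  unfold lasBeta
  exact div_pos h0 (by linarith)

theorem lasBeta_le {ε : ℝ} (h0 : 0 < ε) (h1 : ε < 1 / 2) : lasBeta ε ≤ ε / 48 := by
  obtain ⟨-, h, -⟩ := log_lasBeta_bounds h0 h1
  unfold lasBeta
  exact div_le_div_of_nonneg_left h0.le (by norm_num) (by linarith)

theorem le_lasBeta {ε : ℝ} (h0 : 0 < ε) (h1 : ε < 1 / 2) : ε ^ 2 / 512 ≤ lasBeta ε := by
  obtain ⟨-, h, h'⟩ := log_lasBeta_bounds h0 h1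
  unfold lasBeta
  rw [le_div_iff₀ (by linarith)]
  have : ε ^ 2 / 512 * (16 * (32 / ε)) = ε := by field_simp; norm_num
  have h2 : 0 < ε ^ 2 / 512 := by positivity
  nlinarith [mul_le_mul_of_nonneg_left h' h2.le]

/-! ### The total probability of a block with many bad elements -/

/-- A bound for the probability that more than `ε b` elements of a block of `b` elements are bad,
when each is bad with conditional probability at most `βε`. -/
def blockTail (ε : ℝ) (b : ℕ) : ℝ :=
  if ε * b < 1 then lasBeta ε * ε * b
  else lasBeta ε ^ (⌊ε * b⌋₊ + 1) * Real.exp (ε * b)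

/-- The factor `e^{εb}` costs at most 3 per power of `β`, and `3β ≤ ε/16`. -/
theorem blockTail_le_pow {ε : ℝ} (h0 : 0 < ε) (h1 : ε < 1 / 2) {b : ℕ} (hb : ¬ ε * b < 1) :
    blockTail ε b ≤ (ε / 16) ^ (⌊ε * b⌋₊ + 1) := by
  have hβ := lasBeta_pos h0 h1
  rw [blockTail, if_neg hb]
  have h2 : ε * b ≤ (⌊ε * b⌋₊ + 1 : ℕ) := by
    have := (Nat.lt_floor_add_one (ε * (b : ℝ))).le
    exact_mod_cast this
  have h3 : Real.exp (ε * b) ≤ 3 ^ (⌊ε * b⌋₊ + 1) := by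
    refine (Real.exp_le_exp.mpr h2).trans ?_
    rw [← mul_one ((⌊ε * b⌋₊ + 1 : ℕ) : ℝ), Real.exp_nat_mul]
    have := Real.exp_one_lt_d9
    exact pow_le_pow_left₀ (Real.exp_pos _).le (by linarith) _
  have hle := lasBeta_le h0 h1
  calc _ ≤ lasBeta ε ^ (⌊ε * b⌋₊ + 1) * 3 ^ (⌊ε * b⌋₊ + 1) := by gcongr
    _ = (lasBeta ε * 3) ^ (⌊ε * b⌋₊ + 1) := by rw [mul_pow]
    _ ≤ _ := by gcongr; linarith

theorem one_le_floor_of_not_lt {x : ℝ} (h : ¬ x < 1) : 1 ≤ ⌊x⌋₊ := by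
  rw [Nat.one_le_floor_iff]; linarith

/-- One factor `ε/16` is kept to cancel the sum of the geometric series; each of the others is at
most `e^{-2}`, and `2⌊εb⌋ ≥ εb`. -/
theorem blockTail_le_exp {ε : ℝ} (h0 : 0 < ε) (h1 : ε < 1 / 2) {b : ℕ} (hb : ¬ ε * b < 1) :
    blockTail ε b ≤ ε / 16 * Real.exp (-ε) ^ b := by
  refine (blockTail_le_pow h0 h1 hb).trans ?_
  have hfl := one_le_floor_of_not_lt hb
  have h2 := (Nat.lt_floor_add_one (ε * (b : ℝ))).le
  have h3 : ε * b ≤ 2 * ⌊ε * (b : ℝ)⌋₊ := by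
    have : (1 : ℝ) ≤ ⌊ε * (b : ℝ)⌋₊ := by exact_mod_cast hfl
    linarith
  have he : ε / 16 ≤ Real.exp (-2) := by
    have h4 : Real.exp 2 ≤ 9 := by
      have := Real.exp_one_lt_d9
      have h5 : Real.exp 2 = Real.exp 1 * Real.exp 1 := by rw [← Real.exp_add]; norm_num
      have := Real.exp_pos 1
      nlinarith
    have h5 : Real.exp (-2) * Real.exp 2 = 1 := by rw [← Real.exp_add]; norm_num
    have := Real.exp_pos (-2)
    nlinarith
  rw [pow_succ, mul_comm]
  refine mul_le_mul_of_nonneg_left ?_ (by linarith)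
  calc _ ≤ Real.exp (-2) ^ ⌊ε * (b : ℝ)⌋₊ := by gcongr
    _ = Real.exp (-(2 * ⌊ε * (b : ℝ)⌋₊)) := by rw [← Real.exp_nat_mul]; ring_nf
    _ ≤ Real.exp (-(ε * b)) := Real.exp_le_exp.mpr (by linarith)
    _ = _ := by rw [← Real.exp_nat_mul]; ring_nf

/-- All prefixes with short blocks only. -/
theorem sum_blockTail_le_of_small {ε : ℝ} (h0 : 0 < ε) (h1 : ε < 1 / 2) {k : ℕ} (hk : 1 ≤ k)
    (hB : ε * blockSize ε k k < 1) (n : ℕ) :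
    ∑ j ∈ (Finset.range n).filter fun j => (prefixLenInf ε k j : ℝ) ≤ 5 / 2 * k * Real.log k,
      blockTail ε (blockSize ε k (prefixLenInf ε k j)) ≤ 1 / 2 := by
  obtain ⟨hD, hD3, -⟩ := log_lasBeta_bounds h0 h1
  have hk1 : (1 : ℝ) ≤ k := by exact_mod_cast hk
  have hlk : 0 ≤ Real.log k := Real.log_nonneg hk1
  have hβ := lasBeta_pos h0 h1
  have hle : ∀ l, (blockSize ε k l : ℝ) ≤ blockSize ε k k := fun l => by
    exact_mod_cast blockSize_le h0.le k l
  have hBk : (blockSize ε k k : ℝ) ≤ k := by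
    exact_mod_cast blockSize_self_le (by linarith) hk
  have hsum := sum_blockSize_le ε k
    (fun j => (prefixLenInf ε k j : ℝ) ≤ 5 / 2 * k * Real.log k)
    (X := 5 / 2 * k * Real.log k) (Y := k) (by positivity)
    (fun j hj => ⟨hj, (hle _).trans hBk⟩) n
  have e : ∀ j, blockTail ε (blockSize ε k (prefixLenInf ε k j)) =
      lasBeta ε * ε * blockSize ε k (prefixLenInf ε k j) := by
    intro j
    rw [blockTail, if_pos]
    exact (mul_le_mul_of_nonneg_left (hle _) h0.le).trans_lt hB
  simp only [e, ← Finset.mul_sum]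
  refine (mul_le_mul_of_nonneg_left hsum (by positivity)).trans ?_
  -- If even the longest blocks are short, `k` is `O(1/ε²)`. Then `ln k` is `O(ln(1/ε))`, which the
  -- logarithm `D` in the denominator of `β` absorbs.
  have hk2 : ε ^ 2 * k ≤ 3 / 2 := by
    have := lt_blockSize_add_one ε k k
    rw [min_self] at this
    nlinarith
  have hlogk : Real.log k ≤ 2 * Real.log (1 / ε) + 1 / 2 := by
    have h3 : (k : ℝ) ≤ 3 / 2 * (1 / ε) ^ 2 := by
      rw [one_div, inv_pow, ← div_eq_mul_inv, le_div_iff₀ (by positivity)]; linarith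
    have h4 := Real.log_le_log (by linarith) h3
    rw [Real.log_mul (by norm_num) (by positivity), Real.log_pow] at h4
    have h5 := Real.log_le_sub_one_of_pos (show (0 : ℝ) < 3 / 2 by norm_num)
    push_cast at h4
    linarith
  set D := Real.log (8 / (1 - Real.exp (-ε / 2))) with hDdef
  have e2 : lasBeta ε * ε * (5 / 2 * k * Real.log k + k) =
      (ε ^ 2 * k) * (5 / 2 * Real.log k + 1) / (16 * D) := by
    rw [lasBeta, ← hDdef]; ring
  rw [e2, div_le_iff₀ (by linarith)]
  have h6 : (ε ^ 2 * k) * (5 / 2 * Real.log k + 1) ≤ 3 / 2 * (5 / 2 * Real.log k + 1) :=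
    mul_le_mul_of_nonneg_right hk2 (by linarith)
  have hLe : 0 ≤ Real.log (1 / ε) := Real.log_nonneg (by
    rw [le_div_iff₀ h0]; linarith)
  nlinarith

/-- A block shorter than `1/ε` starts before `1/ε² + 1/ε` when the maximal block is not short. So
these blocks cover `O(1/ε²)` elements, each bad with probability at most `βε ≤ ε²/48`. -/
theorem sum_blockTail_le_of_short {ε : ℝ} (h0 : 0 < ε) (h1 : ε < 1 / 2) {k : ℕ}
    (hB : ¬ ε * blockSize ε k k < 1) (n : ℕ) :
    ∑ j ∈ (Finset.range n).filter fun j => ε * blockSize ε k (prefixLenInf ε k j) < 1,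
      blockTail ε (blockSize ε k (prefixLenInf ε k j)) ≤ 1 / 20 := by
  have hβ := lasBeta_pos h0 h1
  have hβ2 := lasBeta_le h0 h1
  have hsum := sum_blockSize_le ε k
    (fun j => ε * blockSize ε k (prefixLenInf ε k j) < 1)
    (X := 1 / ε ^ 2 + 1 / ε) (Y := 1 / ε) (by positivity)
    (fun j hj => by
      have hlt : prefixLenInf ε k j < k := by
        by_contra h
        rw [blockSize_of_le (not_lt.mp h)] at hj
        exact hB hj
      have h2 := lt_blockSize_add_one ε k (prefixLenInf ε k j)
      rw [min_eq_left hlt.le] at h2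
      have h3 : (blockSize ε k (prefixLenInf ε k j) : ℝ) ≤ 1 / ε := by
        rw [le_div_iff₀ h0]; linarith
      refine ⟨?_, h3⟩
      have e : 1 / ε ^ 2 + 1 / ε = (1 / ε + 1) / ε := by field_simp
      rw [e, le_div_iff₀ h0]
      linarith) n
  have e : ∀ j ∈ (Finset.range n).filter
      (fun j => ε * blockSize ε k (prefixLenInf ε k j) < 1),
      blockTail ε (blockSize ε k (prefixLenInf ε k j)) =
      lasBeta ε * ε * blockSize ε k (prefixLenInf ε k j) := by
    intro j hj
    rw [blockTail, if_pos (Finset.mem_filter.mp hj).2]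
  rw [Finset.sum_congr rfl e, ← Finset.mul_sum]
  refine (mul_le_mul_of_nonneg_left hsum (by positivity)).trans ?_
  have e2 : lasBeta ε * ε * (1 / ε ^ 2 + 1 / ε + 1 / ε) = lasBeta ε * (1 / ε + 2) := by
    field_simp; ring
  rw [e2]
  have h4 : lasBeta ε * (1 / ε + 2) ≤ ε / 48 * (1 / ε + 2) :=
    mul_le_mul_of_nonneg_right hβ2 (by positivity)
  have e3 : ε / 48 * (1 / ε + 2) = (1 + 2 * ε) / 48 := by field_simp
  linarith

theorem two_lt_of_not_lt {ε : ℝ} (h0 : 0 < ε) (h1 : ε < 1 / 2) {b : ℕ} (hb : ¬ ε * b < 1) :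
    2 < b := by
  have : (2 : ℝ) < b := by
    by_contra h
    push Not at h hb
    nlinarith
  exact_mod_cast this

/-- Below `k`, blocks with `εb ≥ 1` have strictly increasing sizes in spite of rounding, since the
next `ε l` exceeds the last by `εb ≥ 1`. Hence the sum is part of a geometric series in the block
size. -/
theorem sum_blockTail_le_of_geometric {ε : ℝ} (h0 : 0 < ε) (h1 : ε < 1 / 2) {k : ℕ} (n : ℕ) :
    ∑ j ∈ (Finset.range n).filter fun j => ¬ ε * blockSize ε k (prefixLenInf ε k j) < 1 ∧
        prefixLenInf ε k j < k,
      blockTail ε (blockSize ε k (prefixLenInf ε k j)) ≤ 1 / 8 := by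
  set S := (Finset.range n).filter fun j => ¬ ε * blockSize ε k (prefixLenInf ε k j) < 1 ∧
        prefixLenInf ε k j < k with hS
  have hlt : ∀ i ∈ S, ∀ j ∈ S, i < j →
      blockSize ε k (prefixLenInf ε k i) < blockSize ε k (prefixLenInf ε k j) := by
    intro i hi j hj hij
    obtain ⟨-, hi1, hi2⟩ := Finset.mem_filter.mp hi
    obtain ⟨-, hj1, hj2⟩ := Finset.mem_filter.mp hj
    have h3 := two_lt_of_not_lt h0 h1 hi1
    have h4 := blockSize_le_of_ne_one h0.le (show blockSize ε k (prefixLenInf ε k i) ≠ 1 by omega)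
    have h5 := lt_blockSize_add_one ε k (prefixLenInf ε k j)
    rw [min_eq_left hi2.le] at h4
    rw [min_eq_left hj2.le] at h5
    have h6 : prefixLenInf ε k i + blockSize ε k (prefixLenInf ε k i) ≤ prefixLenInf ε k j :=
      (prefixLenInf_strictMono ε k).monotone (Nat.succ_le_of_lt hij)
    have h7 : (prefixLenInf ε k i : ℝ) + blockSize ε k (prefixLenInf ε k i) ≤
        prefixLenInf ε k j := by exact_mod_cast h6
    have h8 : (blockSize ε k (prefixLenInf ε k i) : ℝ) < blockSize ε k (prefixLenInf ε k j) := by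
      push Not at hi1
      nlinarith
    exact_mod_cast h8
  have hinj : Set.InjOn (fun j => blockSize ε k (prefixLenInf ε k j)) S := by
    intro i hi j hj hij
    rcases lt_trichotomy i j with h | h | h
    · exact absurd hij (hlt i hi j hj h).ne
    · exact h
    · exact absurd hij (hlt j hj i hi h).ne'
  set w := Real.exp (-ε) with hw
  have hw0 : 0 < w := Real.exp_pos _
  have hw1 : ε / 2 ≤ 1 - w := by
    have h := Real.add_one_le_exp ε
    have h2 : w * Real.exp ε = 1 := by rw [hw, ← Real.exp_add]; simp
    nlinarith
  calc _ ≤ ∑ j ∈ S, ε / 16 * w ^ blockSize ε k (prefixLenInf ε k j) := by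
        refine Finset.sum_le_sum fun j hj => blockTail_le_exp h0 h1 ?_
        exact (Finset.mem_filter.mp hj).2.1
    _ = ε / 16 * ∑ b ∈ S.image fun j => blockSize ε k (prefixLenInf ε k j), w ^ b := by
        rw [← Finset.mul_sum, Finset.sum_image hinj]
    _ ≤ ε / 16 * (1 - w)⁻¹ := by
        refine mul_le_mul_of_nonneg_left ?_ (by linarith)
        rw [← tsum_geometric_of_lt_one hw0.le (by linarith)]
        exact (summable_geometric_of_lt_one hw0.le (by linarith)).sum_le_tsum _
          fun i _ => by positivity
    _ ≤ ε / 16 * (ε / 2)⁻¹ := by gcongr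
    _ = 1 / 8 := by field_simp; norm_num

/-- Beyond `k` all blocks have the same size `b`, and `O(1 + ln k / ε)` of them count. With `⌊εb⌋ =
1 + m`, `ln k` is `O(m + 1/ε)`; in the tail bound `(ε/16)² 32^{-m}` the square absorbs both factors
`1/ε`, and the power absorbs `m`. -/
theorem sum_blockTail_le_of_linear {ε : ℝ} (h0 : 0 < ε) (h1 : ε < 1 / 2) {k : ℕ} (hk : 1 ≤ k)
    (hB : ¬ ε * blockSize ε k k < 1) (n : ℕ) :
    ∑ j ∈ (Finset.range n).filter fun j =>
        (prefixLenInf ε k j : ℝ) ≤ 5 / 2 * k * Real.log k ∧ k ≤ prefixLenInf ε k j,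
      blockTail ε (blockSize ε k (prefixLenInf ε k j)) ≤ 1 / 10 := by
  have hk1 : (1 : ℝ) ≤ k := by exact_mod_cast hk
  have hlk : 0 ≤ Real.log k := Real.log_nonneg hk1
  set P : ℕ → Prop := fun j =>
    (prefixLenInf ε k j : ℝ) ≤ 5 / 2 * k * Real.log k ∧ k ≤ prefixLenInf ε k j with hP
  set b := blockSize ε k k with hb
  have e : ∀ j ∈ (Finset.range n).filter P, blockSize ε k (prefixLenInf ε k j) = b :=
    fun j hj => blockSize_of_le (Finset.mem_filter.mp hj).2.2
  have hsum := sum_blockSize_le ε k P (X := 5 / 2 * k * Real.log k) (Y := b) (by positivity)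
    (fun j hj => ⟨hj.1, by rw [blockSize_of_le hj.2]⟩) n
  rw [Finset.sum_congr rfl fun j hj => by rw [e j hj], Finset.sum_const, nsmul_eq_mul] at hsum ⊢
  set c : ℝ := (((Finset.range n).filter P).card : ℝ) with hc
  have hc0 : 0 ≤ c := by positivity
  have h2b := two_lt_of_not_lt h0 h1 hB
  have h2b' : (2 : ℝ) < b := by exact_mod_cast h2b
  obtain ⟨m, hm⟩ := Nat.exists_eq_add_of_le (one_le_floor_of_not_lt hB)
  have hkb : ε * k ≤ 3 / 2 * b := by
    have := lt_blockSize_add_one ε k k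
    rw [min_self, ← hb] at this
    linarith
  have hcard : c ≤ 1 + 15 / 4 / ε * Real.log k := by
    have h3 : c * b ≤ (1 + 15 / 4 / ε * Real.log k) * b := by
      have h4 : (k : ℝ) ≤ 3 / 2 * b / ε := by rw [le_div_iff₀ h0]; linarith
      have h5 : 5 / 2 * k * Real.log k ≤ 5 / 2 * (3 / 2 * b / ε) * Real.log k := by gcongr
      have h6 : 5 / 2 * (3 / 2 * b / ε) * Real.log k + b =
        (1 + 15 / 4 / ε * Real.log k) * b := by ring
      linarith
    exact le_of_mul_le_mul_right h3 (by linarith)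
  have hbr : ε * b ≤ m + 2 := by
    have := (Nat.lt_floor_add_one (ε * (b : ℝ))).le
    rw [hm] at this
    push_cast at this
    linarith
  have hlog : Real.log k ≤ 3 / 2 * (m + 2) + 2 / ε := by
    have h4 : (k : ℝ) ≤ 3 / 2 * (m + 2) * (1 / ε) ^ 2 := by
      rw [one_div, inv_pow, ← div_eq_mul_inv, le_div_iff₀ (by positivity)]; nlinarith
    have h5 := Real.log_le_log (by linarith) h4
    rw [Real.log_mul (by positivity) (by positivity), Real.log_pow] at h5
    have h6 := Real.log_le_sub_one_of_pos (show (0 : ℝ) < 3 / 2 * (m + 2) by positivity)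
    have h7 := Real.log_le_sub_one_of_pos (show (0 : ℝ) < 1 / ε by positivity)
    have h8 : 2 / ε = 2 * (1 / ε) := by ring
    push_cast at h5
    linarith
  have htail : blockTail ε b ≤ (ε / 16) ^ 2 * (1 / 32) ^ m := by
    refine (blockTail_le_pow h0 h1 hB).trans ?_
    rw [hm, show 1 + m + 1 = 2 + m by ring, pow_add]
    exact mul_le_mul_of_nonneg_left (pow_le_pow_left₀ (by linarith) (by linarith) _)
      (by positivity)
  have hpow : (m + 1 : ℝ) * (1 / 32) ^ m ≤ 1 := by
    rw [one_div, inv_pow, mul_inv_le_iff₀ (by positivity), one_mul]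
    have h9 : m < 2 ^ m := Nat.lt_two_pow_self
    have h10 : (m + 1 : ℝ) ≤ 2 ^ m := by exact_mod_cast h9
    exact h10.trans (by gcongr; norm_num)
  calc c * blockTail ε b ≤ (1 + 15 / 4 / ε * (3 / 2 * (m + 2) + 2 / ε)) *
        ((ε / 16) ^ 2 * (1 / 32) ^ m) := by
        refine mul_le_mul (hcard.trans ?_) htail ?_ (by positivity)
        · gcongr
        · rw [blockTail, if_neg hB]
          have := lasBeta_pos h0 h1
          positivity
    _ = (ε ^ 2 + 45 / 8 * ε * (m + 2) + 15 / 2) / 256 * (1 / 32) ^ m := by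
        field_simp; ring
    _ ≤ (20 * (m + 1)) / 256 * (1 / 32) ^ m := by
        refine mul_le_mul_of_nonneg_right ?_ (by positivity)
        have hm0 : (0 : ℝ) ≤ m := by positivity
        have : ε * (m + 2) ≤ 1 / 2 * (m + 2) := by nlinarith
        gcongr
        nlinarith
    _ = 20 / 256 * ((m + 1) * (1 / 32) ^ m) := by ring
    _ ≤ 1 / 10 := by linarith

/-- The union bound over all blocks that can occur before few candidates are left. -/
theorem sum_blockTail_le {ε : ℝ} (h0 : 0 < ε) (h1 : ε < 1 / 2) {k : ℕ} (hk : 1 ≤ k) (n : ℕ) :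
    ∑ j ∈ (Finset.range n).filter fun j => (prefixLenInf ε k j : ℝ) ≤ 5 / 2 * k * Real.log k,
      blockTail ε (blockSize ε k (prefixLenInf ε k j)) ≤ 1 / 2 := by
  by_cases hB : ε * blockSize ε k k < 1
  · exact sum_blockTail_le_of_small h0 h1 hk hB n
  have hS := sum_blockTail_le_of_short h0 h1 hB n
  have hG := sum_blockTail_le_of_geometric h0 h1 (k := k) n
  have hL := sum_blockTail_le_of_linear h0 h1 hk hB n
  rw [Finset.sum_filter] at *
  have hβ := lasBeta_pos h0 h1
  have hnn : ∀ b, 0 ≤ blockTail ε b := fun b => by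
    rw [blockTail]; split_ifs <;> positivity
  refine le_trans (b := (1 / 20 + 1 / 8 + 1 / 10 : ℝ)) ?_ (by norm_num)
  refine le_trans ?_ (add_le_add (add_le_add hS hG) hL)
  rw [← Finset.sum_add_distrib, ← Finset.sum_add_distrib]
  refine Finset.sum_le_sum fun j _ => ?_
  have := hnn (blockSize ε k (prefixLenInf ε k j))
  by_cases c1 : ε * blockSize ε k (prefixLenInf ε k j) < 1 <;>
  by_cases c2 : prefixLenInf ε k j < k <;>
  by_cases c3 : (prefixLenInf ε k j : ℝ) ≤ 5 / 2 * k * Real.log k <;>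
  simp [c1, c2, c3, not_lt.mp, this] <;> simp [not_le.mpr, c2]

end PrefixLengths

/-! ### Monotone submodular functions -/

noncomputable section Contraction

variable {V : Type*} [DecidableEq V] {f : Finset V → ℝ}

theorem marginalGain_nonneg (hm : Monotone f) (X S : Finset V) : 0 ≤ marginalGain f X S :=
  sub_nonneg.mpr (hm Finset.subset_union_right)

theorem marginalGain_eq_zero_of_mem {x : V} {S : Finset V} (h : x ∈ S) :
    marginalGain f {x} S = 0 := by
  rw [marginalGain, Finset.union_eq_right.mpr (Finset.singleton_subset_iff.mpr h), sub_self]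

theorem IsSubmodularFn.marginalGain_singleton_anti (hs : IsSubmodularFn f) (hm : Monotone f)
    {S T : Finset V} (h : S ⊆ T) (x : V) : marginalGain f {x} T ≤ marginalGain f {x} S := by
  by_cases hx : x ∈ T
  · rw [marginalGain_eq_zero_of_mem hx]; exact marginalGain_nonneg hm _ _
  · exact hs S T h x hx

theorem IsSubmodularFn.marginalGain_anti (hs : IsSubmodularFn f) (hm : Monotone f)
    {S T : Finset V} (h : S ⊆ T) (X : Finset V) : marginalGain f X T ≤ marginalGain f X S := by
  induction X using Finset.induction_on with
  | empty => simp [marginalGain]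
  | insert x X _ ih =>
    have e : ∀ R : Finset V, marginalGain f (insert x X) R =
        marginalGain f X R + marginalGain f {x} (X ∪ R) := by
      intro R
      simp only [marginalGain, Finset.insert_eq, Finset.union_assoc]; ring
    rw [e, e]
    exact add_le_add ih
      (hs.marginalGain_singleton_anti hm (Finset.union_subset_union_right h) x)

theorem IsSubmodularFn.marginalGain_le_sum (hs : IsSubmodularFn f) (hm : Monotone f)
    (X S : Finset V) : marginalGain f X S ≤ ∑ x ∈ X, marginalGain f {x} S := by
  induction X using Finset.induction_on with
  | empty => simp [marginalGain]
  | insert x X hx ih =>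
    have e : marginalGain f (insert x X) S =
        marginalGain f X S + marginalGain f {x} (X ∪ S) := by
      simp only [marginalGain, Finset.insert_eq, Finset.union_assoc]; ring
    rw [e, Finset.sum_insert hx, add_comm]
    exact add_le_add
      (hs.marginalGain_singleton_anti hm Finset.subset_union_right x) ih

theorem IsSubmodularFn.marginalGain_le (hs : IsSubmodularFn f) (hm : Monotone f)
    (h0 : ∀ S, 0 ≤ f S) (X S : Finset V) : marginalGain f X S ≤ f X := by
  refine (hs.marginalGain_anti hm (Finset.empty_subset S) X).trans ?_
  rw [marginalGain, Finset.union_empty]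
  linarith [h0 ∅]

/-! ### One iteration of the loop -/

/-- The candidates in `U` that are filtered out once `w` has been appended to `A`. -/
def deadSet (f : Finset V → ℝ) (k : ℕ) (A : List V) (U : Finset V) (w : List V) : Finset V :=
  U \ filterSet f k (A ++ w) U

theorem mem_deadSet {k : ℕ} {A : List V} {U : Finset V} {w : List V} {x : V} :
    x ∈ deadSet f k A U w ↔ x ∈ U ∧ (x ∈ A ++ w ∨
      marginalGain f {x} (A ++ w).toFinset < f (A ++ w).toFinset / k) := by
  rw [deadSet, Finset.mem_sdiff, filterSet, Finset.mem_filter, ← not_le]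
  tauto

theorem card_filterSet_add_card_deadSet {k : ℕ} {A : List V} {U : Finset V} (w : List V) :
    (filterSet f k (A ++ w) U).card + (deadSet f k A U w).card = U.card := by
  rw [deadSet, add_comm]
  exact Finset.card_sdiff_add_card_eq_card (Finset.filter_subset _ _)

/-- Appending elements lowers marginal gains and raises the threshold, so a candidate that is ruled
out stays ruled out. -/
theorem deadSet_subset_append (hm : Monotone f) (hs : IsSubmodularFn f) {k : ℕ} {A : List V}
    {U : Finset V} (w r : List V) : deadSet f k A U w ⊆ deadSet f k A U (w ++ r) := by
  intro x hx
  rw [mem_deadSet] at hx ⊢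
  have hsub : (A ++ w).toFinset ⊆ (A ++ (w ++ r)).toFinset := by
    intro y hy
    simp only [List.mem_toFinset, List.mem_append] at hy ⊢
    tauto
  refine ⟨hx.1, ?_⟩
  rcases hx.2 with h | h
  · left
    simp only [List.mem_append] at h ⊢
    tauto
  · right
    refine (hs.marginalGain_singleton_anti hm hsub x).trans_lt (h.trans_le ?_)
    have := hm hsub
    gcongr

theorem card_deadSet_take_mono (hm : Monotone f) (hs : IsSubmodularFn f) {k : ℕ} {A : List V}
    {U : Finset V} (v : List V) {a b : ℕ} (h : a ≤ b) :
    (deadSet f k A U (v.take a)).card ≤ (deadSet f k A U (v.take b)).card := by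
  refine Finset.card_le_card ?_
  obtain ⟨c, rfl⟩ := Nat.exists_eq_add_of_le h
  rw [List.take_add]
  exact deadSet_subset_append hm hs _ _

/-- While fewer than a fraction `γ` of the candidates are filtered out, the element `x` is one of
these. -/
def BadElement (f : Finset V → ℝ) (k : ℕ) (A : List V) (U : Finset V) (γ : ℝ) (w : List V)
    (x : V) : Prop :=
  ((deadSet f k A U w).card : ℝ) < γ * U.card ∧ x ∈ deadSet f k A U w

/-- With `D` the dead set, `w ⊆ D`, so `|D| - |w|` of the `|U| - |w|` remaining candidates are dead;
if `|D| < γ|U|`, this is a fraction of at most `γ`. For larger `D` the event is switched off by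
definition, which makes the bound hold for every history. -/
theorem condProbLE_badElement {k : ℕ} {A : List V} {U : Finset V} {γ : ℝ} (hγ0 : 0 ≤ γ)
    (hγ1 : γ ≤ 1) : CondProbLE (BadElement f k A U γ) U γ := by
  classical
  intro w hw hwU
  have hc : w.toFinset.card = w.length := List.toFinset_card_of_nodup hw
  have hle : (w.length : ℝ) ≤ U.card := by
    rw [← hc]; exact_mod_cast Finset.card_le_card hwU
  by_cases h : ((deadSet f k A U w).card : ℝ) < γ * U.card
  · have hsub : w.toFinset ⊆ deadSet f k A U w := by
      intro x hx
      rw [mem_deadSet]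
      exact ⟨hwU hx, Or.inl (List.mem_append_right _ (List.mem_toFinset.mp hx))⟩
    have h2 : ((U \ w.toFinset).filter (BadElement f k A U γ w)) ⊆
        deadSet f k A U w \ w.toFinset := by
      intro x hx
      simp only [Finset.mem_filter, Finset.mem_sdiff] at hx ⊢
      exact ⟨hx.2.2, hx.1.2⟩
    have h3 := Finset.card_le_card h2
    have h4 := Finset.card_sdiff_add_card_eq_card hsub
    have h5 : ((((U \ w.toFinset).filter (BadElement f k A U γ w)).card + w.length : ℕ) : ℝ) ≤
        (deadSet f k A U w).card := by
      exact_mod_cast by omega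
    push_cast at h5
    have h6 : (0 : ℝ) ≤ w.length := by positivity
    nlinarith
  · have h2 : ((U \ w.toFinset).filter (BadElement f k A U γ w)) = ∅ := by
      rw [Finset.filter_eq_empty_iff]
      intro x _ hx
      exact h hx.1
    rw [h2]
    simp only [Finset.card_empty, Nat.cast_zero]
    exact mul_nonneg hγ0 (by linarith)

theorem extendBy_succ {A v : List V} {l : ℕ} (h : l < v.length) :
    extendBy A v (l + 1) = {v[l]} ∪ extendBy A v l := by
  rw [extendBy, extendBy, List.take_succ_eq_append_getElem h, ← List.append_assoc,
    List.toFinset_append, Finset.union_comm]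
  simp

theorem extendBy_mono (A v : List V) {a b : ℕ} (h : a ≤ b) : extendBy A v a ⊆ extendBy A v b := by
  obtain ⟨c, rfl⟩ := Nat.exists_eq_add_of_le h
  intro x hx
  simp only [extendBy, List.take_add, List.mem_toFinset, List.mem_append] at hx ⊢
  tauto

theorem extendBy_zero (A v : List V) : extendBy A v 0 = A.toFinset := by
  simp [extendBy]

/-- By `hd` the cut-off in `BadElement` is inactive, so an element that is not bad was still alive
when it arrived. It gains at least the threshold of that moment, which is no smaller than the one at
the start. -/
theorem gain_ge_of_eventCount (hm : Monotone f) {k : ℕ} {A : List V}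
    {U : Finset V} {γ : ℝ} {v : List V} (hv : v ∈ orderings U) (a m : ℕ)
    (hlen : a + m ≤ v.length)
    (hd : ∀ l < a + m, ((deadSet f k A U (v.take l)).card : ℝ) < γ * U.card) :
    ((m : ℝ) - eventCount (BadElement f k A U γ) (Finset.Ico a (a + m)) v) *
      (f (extendBy A v a) / k) ≤ f (extendBy A v (a + m)) - f (extendBy A v a) := by
  induction m with
  | zero => simp [eventCount]
  | succ m ih =>
    have ih := ih (by omega) (fun l hl => hd l (by omega))
    have hl : a + m < v.length := by omega
    rw [show a + (m + 1) = a + m + 1 by ring, extendBy_succ hl]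
    have hxU : v[a + m] ∈ U := by
      rw [← (mem_orderings.mp hv).2]; simp
    have hins : Finset.Ico a (a + m + 1) = insert (a + m) (Finset.Ico a (a + m)) := by
      ext i; simp only [Finset.mem_Ico, Finset.mem_insert]; omega
    have hev : EventAt (BadElement f k A U γ) v (a + m) ↔
        v[a + m] ∈ deadSet f k A U (v.take (a + m)) := by
      simp only [EventAt, List.getElem?_eq_getElem hl, Option.some.injEq, exists_eq_left',
        BadElement]
      exact and_iff_right (hd _ (by omega))
    have hg := marginalGain_nonneg hm {v[a + m]} (extendBy A v (a + m))
    have hgdef : f ({v[a + m]} ∪ extendBy A v (a + m)) =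
      f (extendBy A v (a + m)) + marginalGain f {v[a + m]} (extendBy A v (a + m)) := by
      rw [marginalGain]; ring
    have hmono := hm (extendBy_mono A v (Nat.le_add_right a m))
    rw [hgdef, eventCount, hins, Finset.filter_insert]
    split_ifs with h
    · rw [Finset.card_insert_of_notMem (by simp)]
      rw [eventCount] at ih
      push_cast
      linarith
    · rw [hev, mem_deadSet, not_and_or, not_or, not_lt] at h
      have h2 := (h.resolve_left (not_not.mpr hxU)).2
      have h3 : f (extendBy A v a) / k ≤ f (extendBy A v (a + m)) / k := by gcongr
      have h4 : f (extendBy A v (a + m)) / k ≤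
        marginalGain f {v[a + m]} (extendBy A v (a + m)) := h2
      rw [eventCount] at ih
      push_cast
      linarith

/-- Good blocks make the value grow exponentially. -/
theorem exp_growth_of_blockGood {ε : ℝ} (h0 : 0 < ε) (h1 : ε < 1 / 2)
    (hf0 : ∀ S, 0 ≤ f S) {k : ℕ} (hk : 1 ≤ k) (A v : List V) (i : ℕ)
    (hi : prefixLenInf ε k i ≤ v.length) (hgood : ∀ j < i, BlockGood f ε k A v j) :
    f A.toFinset * Real.exp (2 / 5 * prefixLenInf ε k i / k) ≤
      f (extendBy A v (prefixLenInf ε k i)) := by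
  induction i with
  | zero => simp [prefixLenInf, extendBy_zero]
  | succ i ih =>
    have hlt := prefixLenInf_strictMono ε k (Nat.lt_add_one i)
    have ih := ih (by omega) (fun j hj => hgood j (by omega))
    have hb := hgood i (by omega)
    rw [BlockGood, prefixLen_eq_min, prefixLen_eq_min, min_eq_right hi,
      min_eq_right (by omega)] at hb
    set l := prefixLenInf ε k i with hl
    have hsucc : prefixLenInf ε k (i + 1) = l + blockSize ε k l := rfl
    rw [hsucc] at hb ⊢
    have hk1 : (1 : ℝ) ≤ k := by exact_mod_cast hk
    have hbk : (blockSize ε k l : ℝ) ≤ k := by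
      exact_mod_cast (blockSize_le h0.le k l).trans (blockSize_self_le (by linarith) hk)
    set b := blockSize ε k l with hbdef
    have hx0 : (0 : ℝ) ≤ b / (2 * k) := by positivity
    have hx1 : (b : ℝ) / (2 * k) ≤ 1 / 2 := by
      rw [div_le_iff₀ (by linarith)]; linarith
    -- A good block multiplies the value by at least `1 + (1-ε)b/k ≥ 1 + x` with `x = b/(2k) ≤ 1/2`,
    -- and `ln(1+x) ≥ 2x/(x+2) ≥ 4x/5`; hence the rate `2/5`.
    have hexp : Real.exp (2 / 5 * b / k) ≤ 1 + b / (2 * k) := by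
      rw [← Real.le_log_iff_exp_le (by linarith)]
      refine le_trans ?_ (Real.le_log_one_add_of_nonneg hx0)
      rw [le_div_iff₀ (by linarith)]
      have e : 2 / 5 * (b : ℝ) / k = 4 / 5 * (b / (2 * k)) := by field_simp; ring
      rw [e]
      nlinarith
    push_cast at hb ⊢
    have e1 : 2 / 5 * ((l : ℝ) + b) / k = 2 / 5 * l / k + 2 / 5 * b / k := by ring
    rw [e1, Real.exp_add, ← mul_assoc]
    calc _ ≤ f (extendBy A v l) * (1 + b / (2 * k)) :=
          mul_le_mul ih hexp (Real.exp_pos _).le (hf0 _)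
      _ = f (extendBy A v l) + b * (1 / 2 * f (extendBy A v l) / k) := by
          field_simp
      _ ≤ f (extendBy A v l) + b * ((1 - ε) * f (extendBy A v l) / k) := by
          have := hf0 (extendBy A v l)
          gcongr
          linarith
      _ ≤ _ := by
          have e2 : (l : ℝ) + b - l = b := by ring
          rw [e2] at hb
          linarith

/-- The bound on bad elements is assumed only for early blocks: exponential growth together with one
surviving candidate shows that the block is early. -/
theorem blockGood_of_eventCount_le (hf0 : ∀ S, 0 ≤ f S) (hm : Monotone f)
    (hs : IsSubmodularFn f) {ε : ℝ} (h0 : 0 < ε) (h1 : ε < 1 / 2) {k : ℕ} (hk : 1 ≤ k)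
    {A : List V} {U : Finset V} (hsing : ∀ x ∈ U, f {x} ≤ f A.toFinset)
    {γ : ℝ} (hγ1 : γ ≤ 1) {v : List V} (hv : v ∈ orderings U) (i : ℕ)
    (hN : (prefixLenInf ε k i : ℝ) ≤ 5 / 2 * k * Real.log k →
      (eventCount (BadElement f k A U γ) (Finset.Ico (prefixLenInf ε k i)
        (prefixLenInf ε k i + blockSize ε k (prefixLenInf ε k i))) v : ℝ) ≤
          ε * blockSize ε k (prefixLenInf ε k i))
    (hd : ∀ l < prefixLenInf ε k (i + 1),
      ((deadSet f k A U (v.take l)).card : ℝ) < γ * U.card)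
    (hlen : prefixLenInf ε k (i + 1) ≤ v.length)
    (hgood : ∀ j < i, BlockGood f ε k A v j) : BlockGood f ε k A v i := by
  have hlt := prefixLenInf_strictMono ε k (Nat.lt_add_one i)
  have hgrow := exp_growth_of_blockGood h0 h1 hf0 hk A v i (by omega) hgood
  have hk1 : (1 : ℝ) ≤ k := by exact_mod_cast hk
  rw [BlockGood, prefixLen_eq_min, prefixLen_eq_min, min_eq_right hlen,
    min_eq_right (by omega)]
  set l := prefixLenInf ε k i with hl
  have hsucc : prefixLenInf ε k (i + 1) = l + blockSize ε k l := rfl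
  rw [hsucc] at hd hlen ⊢
  have hb1 := one_le_blockSize ε k l
  have hgain := gain_ge_of_eventCount hm hv l _ hlen hd
  set b := blockSize ε k l with hb
  -- A survivor exists because fewer than `γ|U| ≤ |U|` candidates are dead; it caps the current
  -- value at `k f(x) ≤ k f(A)`.
  obtain ⟨x, hxU, hx⟩ : ∃ x ∈ U, x ∉ deadSet f k A U (v.take l) := by
    by_contra hcon
    push Not at hcon
    have h2 : (U.card : ℝ) ≤ (deadSet f k A U (v.take l)).card := by
      exact_mod_cast Finset.card_le_card fun x hx => hcon x hx
    have h3 := hd l (by omega)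
    have h4 : (0 : ℝ) ≤ U.card := by positivity
    nlinarith
  have hF : f (extendBy A v l) ≤ k * f A.toFinset := by
    rw [mem_deadSet, not_and_or, not_or, not_lt] at hx
    have h2 := (hx.resolve_left (not_not.mpr hxU)).2
    have h3 := h2.trans ((hs.marginalGain_le hm hf0 _ _).trans (hsing x hxU))
    rw [div_le_iff₀ (by linarith)] at h3
    rw [mul_comm]; exact h3
  have e2 : ((l + b : ℕ) : ℝ) - l = b := by push_cast; ring
  rw [e2]
  -- If `f(A) = 0`, growth says nothing, but the cap makes the value at the start of the block zero,
  -- and a good block need only have a non-negative gain.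
  rcases (hf0 A.toFinset).eq_or_lt with hA | hA
  · have h3 : f (extendBy A v l) = 0 := le_antisymm (by rw [← hA] at hF; simpa using hF) (hf0 _)
    rw [h3] at hgain ⊢
    simp only [zero_div, mul_zero] at hgain ⊢
    exact hgain
  · have h4 : Real.exp (2 / 5 * l / k) ≤ k := by
      have := hgrow.trans hF
      rw [mul_comm] at this
      exact le_of_mul_le_mul_right this hA
    rw [← Real.le_log_iff_exp_le (by linarith), div_le_iff₀ (by linarith)] at h4
    have h5 := hN (by linarith)
    refine le_trans ?_ hgain
    have h6 : 0 ≤ f (extendBy A v l) / k := div_nonneg (hf0 _) (by linarith)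
    have e3 : (b : ℝ) * ((1 - ε) * f (extendBy A v l) / k) =
      (b - ε * b) * (f (extendBy A v l) / k) := by ring
    rw [e3]
    exact mul_le_mul_of_nonneg_right (by linarith) h6

/-- If no block has many bad elements, many candidates are filtered out. -/
theorem le_card_deadSet_chosenLen (hf0 : ∀ S, 0 ≤ f S) (hm : Monotone f)
    (hs : IsSubmodularFn f) {ε : ℝ} (h0 : 0 < ε) (h1 : ε < 1 / 2) {k : ℕ} (hk : 1 ≤ k)
    {A : List V} {U : Finset V} (hsing : ∀ x ∈ U, f {x} ≤ f A.toFinset)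
    {γ : ℝ} (hγ1 : γ ≤ 1) {v : List V} (hv : v ∈ orderings U)
    (hN : ∀ i < U.card, (prefixLenInf ε k i : ℝ) ≤ 5 / 2 * k * Real.log k →
      (eventCount (BadElement f k A U γ) (Finset.Ico (prefixLenInf ε k i)
        (prefixLenInf ε k i + blockSize ε k (prefixLenInf ε k i))) v : ℝ) ≤
          ε * blockSize ε k (prefixLenInf ε k i)) :
    γ * U.card ≤ (deadSet f k A U (v.take (chosenLen f ε k A v))).card := by
  classical
  have hlenv := length_of_mem_orderings hv
  have hU0 : (0 : ℝ) ≤ U.card := by positivity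
  have hfull : deadSet f k A U (v.take v.length) = U := by
    ext x
    rw [mem_deadSet]
    refine ⟨fun h => h.1, fun h => ⟨h, Or.inl ?_⟩⟩
    rw [List.take_length, List.mem_append, ← List.mem_toFinset (l := v), (mem_orderings.mp hv).2]
    exact Or.inr h
  have hmono : ∀ a b, a ≤ b → ((deadSet f k A U (v.take a)).card : ℝ) ≤
      (deadSet f k A U (v.take b)).card := fun a b hab => by
    exact_mod_cast card_deadSet_take_mono hm hs v hab
  -- The aim is to show that the chosen prefix reaches the first candidate length at which `γ|U|`
  -- candidates are dead. The full ordering has this property, as it contains all of `U`.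
  have hex : ∃ i, γ * U.card ≤ (deadSet f k A U (v.take (prefixLen ε k v.length i))).card :=
    ⟨v.length, by rw [prefixLen_self, hfull]; nlinarith⟩
  obtain ⟨hspec, hmin⟩ := (⟨Nat.find_spec hex, fun {m} => Nat.find_min hex⟩ :
    _ ∧ ∀ {m}, m < Nat.find hex → _)
  set i0 := Nat.find hex with hi0
  rcases Nat.eq_zero_or_pos i0 with hz | hpos
  · rw [hz] at hspec
    refine hspec.trans (hmono _ _ ?_)
    rw [prefixLen]; omega
  obtain ⟨j, hj⟩ : ∃ j, i0 = j + 1 := ⟨i0 - 1, by omega⟩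
  rw [hj] at hspec hmin
  have hdj := not_le.mp (hmin (Nat.lt_succ_self j))
  have hlj : prefixLen ε k v.length j = prefixLenInf ε k j ∧ prefixLenInf ε k j < v.length := by
    rw [prefixLen_eq_min] at hdj ⊢
    rcases le_or_gt v.length (prefixLenInf ε k j) with h | h
    · rw [min_eq_left h, hfull] at hdj
      nlinarith
    · exact ⟨min_eq_right h.le, h⟩
  rw [hlj.1] at hdj
  have hgood : ∀ i ≤ j, BlockGood f ε k A v i ∨ i = j := by
    intro i
    induction i using Nat.strong_induction_on with
    | _ i ih =>
      intro hij
      rcases hij.eq_or_lt with h | h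
      · exact Or.inr h
      left
      have hle : prefixLenInf ε k (i + 1) ≤ prefixLenInf ε k j :=
        (prefixLenInf_strictMono ε k).monotone h
      have hile := le_prefixLenInf ε k (i + 1)
      refine blockGood_of_eventCount_le hf0 hm hs h0 h1 hk hsing hγ1 hv i
        (hN i (by omega)) (fun l hl => (hmono l _ (by omega)).trans_lt hdj) (by omega) ?_
      intro i' hi'
      exact (ih i' hi' (by omega)).resolve_right (by omega)
  have hgood' : ∀ i < j, BlockGood f ε k A v i := fun i hi =>
    (hgood i hi.le).resolve_right hi.ne
  have hjle := le_prefixLenInf ε k j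
  refine hspec.trans (hmono _ _ ?_)
  rw [chosenLen]
  set e := Nat.findGreatest (EndsInGoodRun f ε k A v) v.length with he
  have hje : j ≤ e := Nat.le_findGreatest (by omega) fun i hi _ => hgood' i hi
  -- All blocks before `j` are good; block `j` has to be covered too. If the floor is zero, the
  -- extension past `e` may be empty, but block `j` is then a single element whose predecessors
  -- leave the dead set small, so it is good itself. Otherwise the extension past `e` is at least as
  -- long as block `j`.
  by_cases hfl : ⌊ε * (min (prefixLenInf ε k j) k : ℕ)⌋₊ = 0
  · have hsize : prefixLenInf ε k (j + 1) = prefixLenInf ε k j + 1 := by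
      rw [prefixLenInf, blockSize, hfl]; simp
    have hjgood : BlockGood f ε k A v j :=
      blockGood_of_eventCount_le hf0 hm hs h0 h1 hk hsing hγ1 hv j
        (hN j (by omega)) (fun l hl => (hmono l _ (by omega)).trans_lt hdj) (by omega) hgood'
    have hje : j + 1 ≤ e := Nat.le_findGreatest (by omega) fun i hi _ => by
      rcases (Nat.lt_succ_iff.mp hi).eq_or_lt with h | h
      · rw [h]; exact hjgood
      · exact hgood' i h
    have h3 := prefixLen_mono ε k v.length hje
    have h4 := prefixLen_le ε k v.length (j + 1)
    exact le_min h4 (h3.trans (Nat.le_add_right _ _))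
  · have h3 := prefixLen_mono ε k v.length hje
    refine min_le_min le_rfl (add_le_add h3 ?_)
    rw [hlj.1] at h3 ⊢
    refine max_le (Nat.one_le_iff_ne_zero.mpr ?_) ?_
    · have : ⌊ε * (min (prefixLenInf ε k j) k : ℕ)⌋₊ ≤
          ⌊ε * (min (prefixLen ε k v.length e) k : ℕ)⌋₊ := by
        refine Nat.floor_le_floor ?_
        have : ((min (prefixLenInf ε k j) k : ℕ) : ℝ) ≤
          ((min (prefixLen ε k v.length e) k : ℕ) : ℝ) := by
            exact_mod_cast min_le_min h3 le_rfl
        gcongr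
      omega
    · refine Nat.floor_le_floor ?_
      have : ((min (prefixLenInf ε k j) k : ℕ) : ℝ) ≤
        ((min (prefixLen ε k v.length e) k : ℕ) : ℝ) := by
          exact_mod_cast min_le_min h3 le_rfl
      gcongr

open Classical in
theorem card_many_bad_le {ε : ℝ} (h0 : 0 < ε) (h1 : ε < 1 / 2) {U : Finset V}
    {B : List V → V → Prop} (hB : CondProbLE B U (lasBeta ε * ε)) (a b : ℕ) :
    (((orderings U).filter fun v =>
      ¬ (eventCount B (Finset.Ico a (a + b)) v : ℝ) ≤ ε * b).card : ℝ) ≤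
      U.card.factorial * blockTail ε b := by
  have hβ := lasBeta_pos h0 h1
  have hβ1 := lasBeta_le h0 h1
  have hc : (Finset.Ico a (a + b)).card = b := by simp
  by_cases hb : ε * b < 1
  · rw [blockTail, if_pos hb]
    refine le_trans ?_ ((card_one_le_eventCount_le (by positivity) hB
      (Finset.Ico a (a + b))).trans_eq (by rw [hc]))
    have : ((orderings U).filter fun v =>
        ¬ (eventCount B (Finset.Ico a (a + b)) v : ℝ) ≤ ε * b) ⊆
        (orderings U).filter fun v => 1 ≤ eventCount B (Finset.Ico a (a + b)) v := by
      intro v hv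
      rw [Finset.mem_filter] at hv ⊢
      refine ⟨hv.1, Nat.one_le_iff_ne_zero.mpr fun h => hv.2 ?_⟩
      rw [h]; push_cast; positivity
    exact_mod_cast Finset.card_le_card this
  · rw [blockTail, if_neg hb]
    -- The choice `z = 1/β` turns the exponent `γ z b` into `εb`.
    have hz : 1 ≤ 1 / lasBeta ε := by rw [le_div_iff₀ hβ]; linarith
    refine le_trans ?_ ((card_le_eventCount_le hz (by positivity) hB
      (Finset.Ico a (a + b)) (⌊ε * b⌋₊ + 1)).trans_eq ?_)
    · have : ((orderings U).filter fun v =>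
        ¬ (eventCount B (Finset.Ico a (a + b)) v : ℝ) ≤ ε * b) ⊆
        (orderings U).filter fun v =>
          ⌊ε * b⌋₊ + 1 ≤ eventCount B (Finset.Ico a (a + b)) v := by
        intro v hv
        rw [Finset.mem_filter] at hv ⊢
        refine ⟨hv.1, Nat.succ_le_of_lt ((Nat.floor_lt (by positivity)).mpr ?_)⟩
        exact not_le.mp hv.2
      exact_mod_cast Finset.card_le_card this
    · rw [hc, one_div_one_div]
      congr 3
      field_simp

/-- In expectation, one iteration filters out a fraction `βε / 2` of the candidates. -/
theorem sum_card_filterSet_le (hf0 : ∀ S, 0 ≤ f S) (hm : Monotone f)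
    (hs : IsSubmodularFn f) {ε : ℝ} (h0 : 0 < ε) (h1 : ε < 1 / 2) {k : ℕ} (hk : 1 ≤ k)
    {A : List V} {U : Finset V} (hsing : ∀ x ∈ U, f {x} ≤ f A.toFinset) :
    ∑ v ∈ orderings U, ((filterSet f k (A ++ v.take (chosenLen f ε k A v)) U).card : ℝ) ≤
      U.card.factorial * ((1 - lasBeta ε * ε / 2) * U.card) := by
  classical
  have hβ := lasBeta_pos h0 h1
  have hβ1 := lasBeta_le h0 h1
  set γ := lasBeta ε * ε with hγ
  have hγ0 : 0 ≤ γ := by positivity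
  have hγ1 : γ ≤ 1 := by nlinarith
  have hB : CondProbLE (BadElement f k A U γ) U γ := condProbLE_badElement hγ0 hγ1
  set J := (Finset.range U.card).filter
    fun j => (prefixLenInf ε k j : ℝ) ≤ 5 / 2 * k * Real.log k with hJ
  set E : ℕ → List V → Prop := fun j v =>
    ¬ (eventCount (BadElement f k A U γ) (Finset.Ico (prefixLenInf ε k j)
        (prefixLenInf ε k j + blockSize ε k (prefixLenInf ε k j))) v : ℝ) ≤
          ε * blockSize ε k (prefixLenInf ε k j) with hE
  set fail := (orderings U).filter fun v => ∃ j ∈ J, E j v with hfail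
  have hfailcard : (fail.card : ℝ) ≤ U.card.factorial * (1 / 2) := by
    have hsub : fail ⊆ J.biUnion fun j => (orderings U).filter (E j) := by
      intro v hv
      obtain ⟨hv1, j, hj, hv2⟩ := Finset.mem_filter.mp hv
      exact Finset.mem_biUnion.mpr ⟨j, hj, Finset.mem_filter.mpr ⟨hv1, hv2⟩⟩
    have h3 := (Finset.card_le_card hsub).trans Finset.card_biUnion_le
    calc (fail.card : ℝ) ≤ ((∑ j ∈ J, ((orderings U).filter (E j)).card : ℕ) : ℝ) := by
          exact_mod_cast h3
      _ ≤ ∑ j ∈ J, U.card.factorial * blockTail ε (blockSize ε k (prefixLenInf ε k j)) := by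
          push_cast
          exact Finset.sum_le_sum fun j _ => card_many_bad_le h0 h1 hB _ _
      _ ≤ _ := by
          rw [← Finset.mul_sum]
          exact mul_le_mul_of_nonneg_left (sum_blockTail_le h0 h1 hk _) (by positivity)
  have hpt : ∀ v ∈ orderings U,
      ((filterSet f k (A ++ v.take (chosenLen f ε k A v)) U).card : ℝ) ≤
        (1 - γ) * U.card + γ * U.card * (if ∃ j ∈ J, E j v then 1 else 0) := by
    intro v hv
    have h3 := card_filterSet_add_card_deadSet (f := f) (k := k) (A := A) (U := U)
      (v.take (chosenLen f ε k A v))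
    have h4 : ((filterSet f k (A ++ v.take (chosenLen f ε k A v)) U).card : ℝ) +
      (deadSet f k A U (v.take (chosenLen f ε k A v))).card = U.card := by exact_mod_cast h3
    have h5 : (0 : ℝ) ≤ (deadSet f k A U (v.take (chosenLen f ε k A v))).card := by positivity
    split_ifs with h
    · linarith
    · push Not at h
      have := le_card_deadSet_chosenLen hf0 hm hs h0 h1 hk hsing hγ1 hv (fun i hi hi2 => by
        have := h i (Finset.mem_filter.mpr ⟨Finset.mem_range.mpr hi, hi2⟩)
        rw [hE] at this
        exact not_not.mp this)
      linarith
  refine (Finset.sum_le_sum hpt).trans ?_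
  rw [Finset.sum_add_distrib, Finset.sum_const, ← Finset.mul_sum, Finset.sum_boole,
    card_orderings, nsmul_eq_mul]
  have h6 : 0 ≤ γ * U.card := by positivity
  nlinarith [mul_le_mul_of_nonneg_left hfailcard h6]

end Contraction

/-! ### Expectations -/

noncomputable section Runs

open scoped ENNReal

/-- Expectation of a non-negative function. -/
def PMF.expect {α : Type*} (P : PMF α) (g : α → ℝ≥0∞) : ℝ≥0∞ := ∑' x, P x * g x

theorem PMF.expect_pure {α : Type*} (a : α) (g : α → ℝ≥0∞) : (PMF.pure a).expect g = g a := by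
  rw [PMF.expect, tsum_eq_single a]
  · simp
  · intro b hb; simp [hb]

theorem PMF.expect_bind {α β : Type*} (P : PMF α) (q : α → PMF β) (g : β → ℝ≥0∞) :
    (P.bind q).expect g = P.expect fun a => (q a).expect g := by
  simp only [PMF.expect, PMF.bind_apply, ← ENNReal.tsum_mul_right, ← ENNReal.tsum_mul_left]
  rw [ENNReal.tsum_comm]
  simp only [mul_assoc]

theorem PMF.expect_map {α β : Type*} (P : PMF α) (h : α → β) (g : β → ℝ≥0∞) :
    (P.map h).expect g = P.expect (g ∘ h) := by
  rw [← PMF.bind_pure_comp, PMF.expect_bind]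
  simp only [Function.comp_def, PMF.expect_pure]

theorem PMF.expect_add_const {α : Type*} (P : PMF α) (g : α → ℝ≥0∞) (c : ℝ≥0∞) :
    (P.expect fun a => g a + c) = P.expect g + c := by
  simp only [PMF.expect, mul_add]
  rw [ENNReal.tsum_add, ENNReal.tsum_mul_right, PMF.tsum_coe, one_mul]

/-- A union bound. The probability of failure `t` appears as an expectation, the form in which it is
bounded by recursion along the loop. -/
theorem PMF.one_le_toOuterMeasure_add_expect {α : Type*} (P : PMF α) (s t : Set α)
    (h : ∀ x ∈ P.support, x ∉ t → x ∈ s) :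
    1 ≤ P.toOuterMeasure s + P.expect (t.indicator 1) := by
  rw [PMF.toOuterMeasure_apply, PMF.expect, ← ENNReal.tsum_add, ← P.tsum_coe]
  refine ENNReal.tsum_le_tsum fun x => ?_
  by_cases hx : P x = 0
  · simp [hx]
  by_cases ht : x ∈ t
  · simp [ht]
  · have := h x ((PMF.mem_support_iff _ _).mpr hx) ht
    simp [this]

variable {V : Type*} [DecidableEq V]

theorem randomOrdering_apply {U : Finset V} {v : List V} :
    randomOrdering U v = if v ∈ orderings U then ((orderings U).card : ℝ≥0∞)⁻¹ else 0 := by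
  refine (PMF.uniformOfFinset_apply (s := orderings U) ⟨U.toList, by simp [orderings]⟩ v).trans ?_
  congr

theorem mem_support_randomOrdering {U : Finset V} {v : List V} :
    v ∈ (randomOrdering U).support ↔ v ∈ orderings U := by
  rw [PMF.mem_support_iff, randomOrdering_apply]
  simp

theorem expect_randomOrdering_le {U : Finset V} {G : List V → ℝ≥0∞} {g : List V → ℝ} {M : ℝ}
    (hG : ∀ v ∈ orderings U, G v ≤ ENNReal.ofReal (g v)) (hg : ∀ v ∈ orderings U, 0 ≤ g v)
    (hM : ∑ v ∈ orderings U, g v ≤ U.card.factorial * M) :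
    (randomOrdering U).expect G ≤ ENNReal.ofReal M := by
  have hf : (0 : ℝ) < U.card.factorial := by exact_mod_cast Nat.factorial_pos _
  have h1 : (randomOrdering U).expect G =
      (U.card.factorial : ℝ≥0∞)⁻¹ * ∑ v ∈ orderings U, G v := by
    rw [PMF.expect, tsum_eq_sum (s := orderings U), Finset.mul_sum]
    · refine Finset.sum_congr rfl fun v hv => ?_
      rw [randomOrdering_apply, if_pos hv, card_orderings]
    · intro v hv
      rw [randomOrdering_apply, if_neg hv, zero_mul]
  rw [h1]
  have h2 : ∑ v ∈ orderings U, G v ≤ ENNReal.ofReal (U.card.factorial * M) := by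
    refine (Finset.sum_le_sum hG).trans ?_
    rw [← ENNReal.ofReal_sum_of_nonneg hg]
    exact ENNReal.ofReal_le_ofReal hM
  rw [ENNReal.ofReal_mul hf.le, ENNReal.ofReal_natCast] at h2
  calc _ ≤ (U.card.factorial : ℝ≥0∞)⁻¹ * (U.card.factorial * ENNReal.ofReal M) := by gcongr
    _ = _ := by
      rw [← mul_assoc, ENNReal.inv_mul_cancel (by exact_mod_cast (Nat.factorial_pos _).ne')
        (ENNReal.natCast_ne_top _), one_mul]

/-! ### Unfolding a run -/

/-- One more adaptive round, with `c` queries. -/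
def RunOutcome.addRound {R : Type*} (c : ℕ) (x : RunOutcome R) : RunOutcome R :=
  ⟨x.output, x.rounds + 1, x.queries + c⟩

variable {f : Finset V → ℝ}

/-- The decisions of the algorithm read only queried values, so the default answer `0` never
matters. Indices beyond `v.length` repeat the full length, which is queried. -/
theorem blockGood_restrict (f : Finset V → ℝ) (ε : ℝ) (k : ℕ) (A v : List V) (i : ℕ) :
    BlockGood (fun S => if S ∈ prefixQueries ε k A v then f S else 0) ε k A v i ↔
      BlockGood f ε k A v i := by
  have h : ∀ i, extendBy A v (prefixLen ε k v.length i) ∈ prefixQueries ε k A v := by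
    intro i
    rw [prefixQueries, Finset.mem_image]
    refine ⟨min i v.length, by simp, ?_⟩
    rcases le_total i v.length with h | h
    · rw [min_eq_left h]
    · rw [min_eq_right h, prefixLen_self]
      congr 1
      refine le_antisymm ?_ (prefixLen_le _ _ _ _)
      have := prefixLen_mono ε k v.length h
      rwa [prefixLen_self] at this
  simp only [BlockGood, h, if_true]

theorem chosenLen_restrict (f : Finset V → ℝ) (ε : ℝ) (k : ℕ) (A v : List V) :
    chosenLen (fun S => if S ∈ prefixQueries ε k A v then f S else 0) ε k A v =
      chosenLen f ε k A v := by
  have : EndsInGoodRun (fun S => if S ∈ prefixQueries ε k A v then f S else 0) ε k A v =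
      EndsInGoodRun f ε k A v := by
    funext i
    simp only [EndsInGoodRun, blockGood_restrict]
  simp only [chosenLen]
  rw [this]

theorem filterSet_restrict (f : Finset V → ℝ) (k : ℕ) (A : List V) (U : Finset V) :
    filterSet (fun S => if S ∈ insert A.toFinset (U.image fun x => {x} ∪ A.toFinset) then f S
      else 0) k A U = filterSet f k A U := by
  refine Finset.filter_congr fun x hx => ?_
  have h : {x} ∪ A.toFinset ∈ insert A.toFinset (U.image fun x => {x} ∪ A.toFinset) :=
    Finset.mem_insert_of_mem (Finset.mem_image_of_mem _ hx)
  simp only [marginalGain, h, Finset.mem_insert_self, if_true]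

theorem run_returnBest (f : Finset V → ℝ) (k : ℕ) (A : List V) (U : Finset V) :
    (returnBest k A U).run f = PMF.pure ⟨some (if f U ≤ f (A.drop (A.length - k)).toFinset
      then (A.drop (A.length - k)).toFinset else U), 1,
      ({(A.drop (A.length - k)).toFinset, U} : Finset (Finset V)).card⟩ := by
  simp [returnBest, AdaptiveAlg.run, PMF.pure_map]

theorem run_lowAdapLoop_zero (f : Finset V → ℝ) (k : ℕ) (ε : ℝ) (A : List V) (U : Finset V) :
    (lowAdapLoop k ε 0 A U).run f =
      if U.card ≤ k then (returnBest k A U).run f else PMF.pure ⟨none, 0, 0⟩ := by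
  rw [lowAdapLoop]
  split_ifs <;> rfl

theorem run_lowAdapLoop_succ (f : Finset V → ℝ) (k : ℕ) (ε : ℝ) (n : ℕ) (A : List V)
    (U : Finset V) :
    (lowAdapLoop k ε (n + 1) A U).run f =
      (if (filterSet f k A U).card ≤ k then (returnBest k A (filterSet f k A U)).run f else
        (randomOrdering (filterSet f k A U)).bind fun v =>
          ((lowAdapLoop k ε n (A ++ v.take (chosenLen f ε k A v)) (filterSet f k A U)).run f).map
            (RunOutcome.addRound (prefixQueries ε k A v).card)).map
        (RunOutcome.addRound (insert A.toFinset (U.image fun x => {x} ∪ A.toFinset)).card) := by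
  rw [lowAdapLoop, AdaptiveAlg.run]
  simp only [filterSet_restrict]
  congr 1
  split_ifs with h
  · rfl
  · simp only [AdaptiveAlg.run, chosenLen_restrict]
    rfl

/-- An invariant of the loop holds for the values with which a run returns. -/
theorem output_of_mem_support_lowAdapLoop {k : ℕ} {ε : ℝ}
    (P : List V → Finset V → Prop)
    (hfilter : ∀ A U, P A U → P A (filterSet f k A U))
    (happend : ∀ A U v, P A U → v ∈ orderings U →
      P (A ++ v.take (chosenLen f ε k A v)) U) (n : ℕ) :
    ∀ A U, P A U → ∀ x ∈ ((lowAdapLoop k ε n A U).run f).support,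
      x.output = none ∨ ∃ A U, P A U ∧ U.card ≤ k ∧
        x.output = some (if f U ≤ f (A.drop (A.length - k)).toFinset
          then (A.drop (A.length - k)).toFinset else U) := by
  induction n with
  | zero =>
    intro A U hP x hx
    rw [run_lowAdapLoop_zero] at hx
    split_ifs at hx with h
    · rw [run_returnBest, PMF.support_pure, Set.mem_singleton_iff] at hx
      exact Or.inr ⟨A, U, hP, h, by rw [hx]⟩
    · rw [PMF.support_pure, Set.mem_singleton_iff] at hx
      exact Or.inl (by rw [hx])
  | succ n ih =>
    intro A U hP x hx
    rw [run_lowAdapLoop_succ, PMF.mem_support_map_iff] at hx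
    obtain ⟨y, hy, rfl⟩ := hx
    have hP' := hfilter A U hP
    split_ifs at hy with h
    · rw [run_returnBest, PMF.support_pure, Set.mem_singleton_iff] at hy
      exact Or.inr ⟨A, _, hP', h, by rw [hy]; rfl⟩
    · rw [PMF.mem_support_bind_iff] at hy
      obtain ⟨v, hv, hy⟩ := hy
      rw [PMF.mem_support_map_iff] at hy
      obtain ⟨z, hz, rfl⟩ := hy
      exact ih _ _ (happend _ _ v hP' (mem_support_randomOrdering.mp hv)) z hz

theorem rounds_lowAdapLoop_le (f : Finset V → ℝ) (k : ℕ) (ε : ℝ) (n : ℕ) :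
    ∀ A U, ∀ x ∈ ((lowAdapLoop k ε n A U).run f).support, x.rounds ≤ 2 * n + 1 := by
  induction n with
  | zero =>
    intro A U x hx
    rw [run_lowAdapLoop_zero] at hx
    split_ifs at hx with h
    · rw [run_returnBest, PMF.support_pure, Set.mem_singleton_iff] at hx
      rw [hx]
    · rw [PMF.support_pure, Set.mem_singleton_iff] at hx
      rw [hx]; exact Nat.zero_le _
  | succ n ih =>
    intro A U x hx
    rw [run_lowAdapLoop_succ, PMF.mem_support_map_iff] at hx
    obtain ⟨y, hy, rfl⟩ := hx
    rw [RunOutcome.addRound]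
    split_ifs at hy with h
    · rw [run_returnBest, PMF.support_pure, Set.mem_singleton_iff] at hy
      rw [hy]
      change 1 + 1 ≤ _
      omega
    · rw [PMF.mem_support_bind_iff] at hy
      obtain ⟨v, hv, hy⟩ := hy
      rw [PMF.mem_support_map_iff] at hy
      obtain ⟨z, hz, rfl⟩ := hy
      have := ih _ _ z hz
      rw [RunOutcome.addRound]
      change z.rounds + 1 + 1 ≤ _
      omega

/-! ### Failure probability -/

/-- The elements of `U` are no more valuable than `A`. -/
def SingletonsLE (f : Finset V → ℝ) (A : List V) (U : Finset V) : Prop :=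
  ∀ x ∈ U, f {x} ≤ f A.toFinset

theorem SingletonsLE.filter {A : List V} {U : Finset V} (h : SingletonsLE f A U) (k : ℕ) :
    SingletonsLE f A (filterSet f k A U) :=
  fun x hx => h x (Finset.filter_subset _ _ hx)

theorem SingletonsLE.append {A : List V} {U : Finset V} (h : SingletonsLE f A U)
    (hm : Monotone f) (w : List V) : SingletonsLE f (A ++ w) U :=
  fun x hx => (h x hx).trans (hm (by rw [List.toFinset_append]; exact Finset.subset_union_left))

/-- A lower bound is what allows one iteration to be given away at the price of a factor 2 in
`contraction_pow_le`. -/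
theorem half_le_contractionFactor {ε : ℝ} (h0 : 0 < ε) (h1 : ε < 1 / 2) :
    1 / 2 ≤ 1 - lasBeta ε * ε / 2 := by
  have hβ := lasBeta_pos h0 h1
  have hβ1 := lasBeta_le h0 h1
  nlinarith

/-- Failure means `|U| > k`, so Markov's inequality applies to `|U|/k`. The elements appended in the
last iteration are not followed by a filtering step; hence `n + 1` iterations give only `n`
contractions. -/
theorem expect_failure_le (hf0 : ∀ S, 0 ≤ f S) (hm : Monotone f)
    (hs : IsSubmodularFn f) {ε : ℝ} (h0 : 0 < ε) (h1 : ε < 1 / 2) {k : ℕ} (hk : 1 ≤ k) (n : ℕ) :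
    ∀ A U, SingletonsLE f A U →
      ((lowAdapLoop k ε (n + 1) A U).run f).expect
        (Set.indicator {x | x.output = none} 1) ≤
      ENNReal.ofReal ((1 - lasBeta ε * ε / 2) ^ n * (filterSet f k A U).card / k) := by
  have hk1 : (1 : ℝ) ≤ k := by exact_mod_cast hk
  have hρ := half_le_contractionFactor h0 h1
  set ρ := 1 - lasBeta ε * ε / 2 with hρdef
  have hcomp : ∀ c, (Set.indicator {x : RunOutcome (Option (Finset V)) | x.output = none}
      (1 : RunOutcome (Option (Finset V)) → ℝ≥0∞)) ∘ (RunOutcome.addRound c) = Set.indicator {x | x.output = none} 1 := by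
    intro c
    funext x
    simp only [Function.comp_def, Set.indicator, Set.mem_ofPred_eq, RunOutcome.addRound,
      Pi.one_apply]
    congr
  induction n with
  | zero =>
    intro A U hA
    rw [run_lowAdapLoop_succ, PMF.expect_map, hcomp]
    split_ifs with h
    · rw [run_returnBest, PMF.expect_pure]
      simp
    · rw [PMF.expect_bind]
      refine expect_randomOrdering_le (g := fun _ => 1) (fun v hv => ?_) (fun _ _ => zero_le_one) ?_
      · rw [PMF.expect_map, hcomp, run_lowAdapLoop_zero, if_neg h, PMF.expect_pure]
        simp
      · rw [Finset.sum_const, card_orderings, nsmul_eq_mul]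
        refine mul_le_mul_of_nonneg_left ?_ (by positivity)
        rw [pow_zero, one_mul, le_div_iff₀ (by linarith), one_mul]
        exact_mod_cast (not_le.mp h).le
  | succ n ih =>
    intro A U hA
    rw [run_lowAdapLoop_succ, PMF.expect_map, hcomp]
    split_ifs with h
    · rw [run_returnBest, PMF.expect_pure]
      simp
    · rw [PMF.expect_bind]
      set U' := filterSet f k A U with hU'
      have hA' : SingletonsLE f A U' := hA.filter k
      refine expect_randomOrdering_le (g := fun v => ρ ^ n * (filterSet f k
        (A ++ v.take (chosenLen f ε k A v)) U').card / k) (fun v hv => ?_)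
        (fun v _ => by positivity) ?_
      · rw [PMF.expect_map, hcomp]
        exact ih _ _ (hA'.append hm _)
      · have h2 := sum_card_filterSet_le hf0 hm hs h0 h1 hk hA'
        rw [← hρdef] at h2
        rw [← Finset.sum_div, ← Finset.mul_sum, pow_succ]
        calc _ ≤ ρ ^ n * (U'.card.factorial * (ρ * U'.card)) / k := by gcongr
          _ = _ := by ring

/-! ### Number of queries -/

/-- At most `k` lengths lie below `k`; from `k` on the step is at least `εk/2`; the full length is
counted separately. -/
theorem card_prefixQueries_le {ε : ℝ} (h0 : 0 < ε) {k : ℕ} (hk : 1 ≤ k) (A v : List V) :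
    ((prefixQueries ε k A v).card : ℝ) ≤ k + 2 + 2 / (ε * k) * v.length := by
  set s := v.length with hs
  have hk1 : (1 : ℝ) ≤ k := by exact_mod_cast hk
  set P : ℕ → Prop := fun j => k ≤ prefixLenInf ε k j ∧ prefixLenInf ε k j ≤ s with hP
  set M := (Finset.range (s + 1)).filter P with hM
  set b := blockSize ε k k with hb
  have hb1 : (1 : ℝ) ≤ b := by exact_mod_cast one_le_blockSize ε k k
  have hεk : ε * k ≤ 2 * b := by
    have := lt_blockSize_add_one ε k k
    rw [min_self, ← hb] at this
    linarith
  have hsum := sum_blockSize_le ε k P (X := s) (Y := b) (by positivity)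
    (fun j hj => ⟨by exact_mod_cast hj.2, by rw [blockSize_of_le hj.1]⟩) (s + 1)
  rw [Finset.sum_congr rfl fun j hj => by rw [blockSize_of_le (Finset.mem_filter.mp hj).2.1],
    Finset.sum_const, nsmul_eq_mul] at hsum
  have hMc : (M.card : ℝ) ≤ 2 / (ε * k) * s + 1 := by
    have h3 : (s : ℝ) ≤ 2 / (ε * k) * s * b := by
      have e : 2 / (ε * k) * s * b = (s : ℝ) * (2 * b) / (ε * k) := by ring
      rw [e, le_div_iff₀ (by positivity)]
      gcongr
    refine le_of_mul_le_mul_right (a := (b : ℝ)) ?_ (by linarith)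
    linarith
  have hsub : prefixQueries ε k A v ⊆
      (Finset.range k ∪ M.image (prefixLen ε k s) ∪ {s}).image (extendBy A v) := by
    intro S hS
    rw [prefixQueries, Finset.mem_image] at hS
    obtain ⟨i, hi, rfl⟩ := hS
    refine Finset.mem_image_of_mem _ ?_
    simp only [Finset.mem_union, Finset.mem_singleton]
    rw [← hs]
    by_cases h1 : prefixLenInf ε k i < k
    · left; left
      rw [Finset.mem_range, prefixLen_eq_min]
      exact (min_le_right _ _).trans_lt h1
    by_cases h2 : prefixLenInf ε k i ≤ s
    · left; right
      exact Finset.mem_image_of_mem _ (Finset.mem_filter.mpr ⟨hi, not_lt.mp h1, h2⟩)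
    · right
      rw [prefixLen_eq_min, min_eq_left (by omega)]
  have hcard : (prefixQueries ε k A v).card ≤ k + M.card + 1 := by
    refine (Finset.card_le_card hsub).trans (Finset.card_image_le.trans ?_)
    refine (Finset.card_union_le _ _).trans (add_le_add ?_ (by simp))
    refine (Finset.card_union_le _ _).trans (add_le_add (by simp) Finset.card_image_le)
  have : ((prefixQueries ε k A v).card : ℝ) ≤ k + M.card + 1 := by exact_mod_cast hcard
  linarith

theorem expectedQueries_map_addRound {R : Type*} (P : PMF (RunOutcome R)) (c : ℕ) :
    expectedQueries (P.map (RunOutcome.addRound c)) = expectedQueries P + c := by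
  have e : ∀ P : PMF (RunOutcome R), expectedQueries P = P.expect fun x => (x.queries : ℝ≥0∞) :=
    fun _ => rfl
  rw [e, e, PMF.expect_map, ← PMF.expect_add_const]
  congr 1
  funext x
  simp [RunOutcome.addRound]

theorem expectedQueries_bind {α R : Type*} (P : PMF α) (q : α → PMF (RunOutcome R)) :
    expectedQueries (P.bind q) = P.expect fun a => expectedQueries (q a) :=
  PMF.expect_bind P q _

theorem expectedQueries_returnBest_le (f : Finset V → ℝ) (k : ℕ) (A : List V) (U : Finset V) :
    expectedQueries ((returnBest k A U).run f) ≤ ENNReal.ofReal 2 := by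
  rw [run_returnBest]
  refine (PMF.expect_pure _ _).trans_le ?_
  have : ({(A.drop (A.length - k)).toFinset, U} : Finset (Finset V)).card ≤ 2 :=
    Finset.card_le_two
  rw [ENNReal.ofReal_ofNat]
  exact_mod_cast this

/-- An amortized count whose potential is `c` times the size of the filtered set. The summand
`U.card` pays for the coming filter round, and `k + 3` for the fixed costs of one iteration. -/
theorem expectedQueries_lowAdapLoop_le (hf0 : ∀ S, 0 ≤ f S) (hm : Monotone f)
    (hs : IsSubmodularFn f) {ε : ℝ} (h0 : 0 < ε) (h1 : ε < 1 / 2) {k : ℕ} (hk : 1 ≤ k) (n : ℕ) :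
    ∀ A U, SingletonsLE f A U →
      expectedQueries ((lowAdapLoop k ε n A U).run f) ≤
      ENNReal.ofReal (U.card + n * (k + 3) +
        2 * (1 + 2 / (ε * k)) / (lasBeta ε * ε) * (filterSet f k A U).card + 2) := by
  have hk1 : (1 : ℝ) ≤ k := by exact_mod_cast hk
  have hβ := lasBeta_pos h0 h1
  set κ : ℝ := 2 / (ε * k) with hκ
  have hκ0 : 0 ≤ κ := by positivity
  set c : ℝ := 2 * (1 + κ) / (lasBeta ε * ε) with hc
  have hc0 : 0 ≤ c := by positivity
  -- The expected drop `cβε/2` of the potential per candidate is exactly the cost per candidate: `κ`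
  -- for prefixes and `1` for the next filter round.
  have hcβ : c * (1 - lasBeta ε * ε / 2) = c - (1 + κ) := by
    rw [hc]; field_simp
  induction n with
  | zero =>
    intro A U hA
    rw [run_lowAdapLoop_zero]
    split_ifs with h
    · refine (expectedQueries_returnBest_le f k A U).trans (ENNReal.ofReal_le_ofReal ?_)
      have : (0 : ℝ) ≤ U.card := by positivity
      have : 0 ≤ c * (filterSet f k A U).card := by positivity
      push_cast
      linarith
    · refine (PMF.expect_pure _ _).trans_le ?_
      simp
  | succ n ih =>
    intro A U hA
    rw [run_lowAdapLoop_succ, expectedQueries_map_addRound]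
    set U' := filterSet f k A U with hU'
    have hA' : SingletonsLE f A U' := hA.filter k
    have hfirst : ((insert A.toFinset (U.image fun x => {x} ∪ A.toFinset)).card : ℝ≥0∞) ≤
        ENNReal.ofReal (U.card + 1) := by
      have h2 : (insert A.toFinset (U.image fun x => {x} ∪ A.toFinset)).card ≤ U.card + 1 :=
        (Finset.card_insert_le _ _).trans (Nat.add_le_add_right Finset.card_image_le 1)
      rw [← ENNReal.ofReal_natCast]
      exact ENNReal.ofReal_le_ofReal (by exact_mod_cast h2)
    have hrest : expectedQueries (if U'.card ≤ k then (returnBest k A U').run f else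
        (randomOrdering U').bind fun v =>
          ((lowAdapLoop k ε n (A ++ v.take (chosenLen f ε k A v)) U').run f).map
            (RunOutcome.addRound (prefixQueries ε k A v).card)) ≤
        ENNReal.ofReal (k + 2 + n * (k + 3) + c * U'.card + 2) := by
      split_ifs with h
      · refine (expectedQueries_returnBest_le f k A U').trans (ENNReal.ofReal_le_ofReal ?_)
        have : 0 ≤ c * U'.card := by positivity
        have : (0 : ℝ) ≤ n * (k + 3) := by positivity
        linarith
      · rw [expectedQueries_bind]
        refine expect_randomOrdering_le (g := fun v => (k + 2 + κ * U'.card + (U'.card +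
          n * (k + 3) + 2)) + c * (filterSet f k
          (A ++ v.take (chosenLen f ε k A v)) U').card) (fun v hv => ?_)
          (fun v _ => by positivity) ?_
        · rw [expectedQueries_map_addRound, ← ENNReal.ofReal_natCast]
          refine (add_le_add (ih _ _ (hA'.append hm _)) (ENNReal.ofReal_le_ofReal
            (card_prefixQueries_le h0 hk A v))).trans ?_
          rw [← ENNReal.ofReal_add (by positivity) (by positivity)]
          refine ENNReal.ofReal_le_ofReal (le_of_eq ?_)
          rw [length_of_mem_orderings hv]
          ring
        · rw [Finset.sum_add_distrib, Finset.sum_const, ← Finset.mul_sum, card_orderings,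
            nsmul_eq_mul]
          have h2 := mul_le_mul_of_nonneg_left
            (sum_card_filterSet_le hf0 hm hs h0 h1 hk hA') hc0
          refine (add_le_add_right h2 _).trans (le_of_eq ?_)
          have e : c * (U'.card.factorial * ((1 - lasBeta ε * ε / 2) * U'.card)) =
            U'.card.factorial * ((c * (1 - lasBeta ε * ε / 2)) * U'.card) := by ring
          rw [e, hcβ]
          ring
    refine (add_le_add hrest hfirst).trans ?_
    rw [← ENNReal.ofReal_add (by positivity) (by positivity)]
    refine ENNReal.ofReal_le_ofReal (le_of_eq ?_)
    push_cast
    ring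

end Runs

/-! ### Approximation guarantee -/

noncomputable section Approximation

variable {V : Type*} [DecidableEq V] {f : Finset V → ℝ}

/-- The gain of a run of good blocks, apart from the first one if `c` lies inside it. -/
theorem exists_gain_of_endsInGoodRun (hm : Monotone f) {ε : ℝ}
    (h0 : 0 < ε) (h1 : ε < 1 / 2) {k : ℕ} {A v : List V} {i c : ℕ}
    (hi : EndsInGoodRun f ε k A v i) (hc : c ≤ prefixLen ε k v.length i)
    (hck : prefixLen ε k v.length i ≤ c + k) :
    ∃ l, c ≤ l ∧ (l : ℝ) ≤ c + ε * k ∧ (c = 0 → l = 0) ∧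
      ((prefixLen ε k v.length i : ℝ) - l) * ((1 - ε) * f (extendBy A v c) / k) ≤
        f (extendBy A v (prefixLen ε k v.length i)) - f (extendBy A v l) := by
  classical
  have hex : ∃ i, c ≤ prefixLen ε k v.length i := ⟨i, hc⟩
  obtain ⟨hspec, hmin⟩ := (⟨Nat.find_spec hex, fun {m} => Nat.find_min hex⟩ :
    _ ∧ ∀ {m}, m < Nat.find hex → _)
  have hi0 : Nat.find hex ≤ i := Nat.find_min' hex hc
  set i0 := Nat.find hex with hi0def
  refine ⟨prefixLen ε k v.length i0, hspec, ?_, ?_, ?_⟩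
  · rcases Nat.eq_zero_or_pos i0 with hz | hpos
    · rw [hz, prefixLen]; push_cast; positivity
    obtain ⟨j, hj⟩ : ∃ j, i0 = j + 1 := ⟨i0 - 1, by omega⟩
    rw [hj] at hmin ⊢
    have hjc := not_le.mp (hmin (Nat.lt_succ_self j))
    have hle : prefixLen ε k v.length (j + 1) ≤ prefixLen ε k v.length j +
        blockSize ε k (prefixLen ε k v.length j) := by
      rw [prefixLen, blockSize]; exact min_le_right _ _
    -- The block containing position `c` has at most `εk` elements, unless rounding made it a single
    -- element; such a block, starting before `c`, cannot pass `c`.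
    by_cases hb : blockSize ε k (prefixLen ε k v.length j) = 1
    · rw [hb] at hle
      have : ((prefixLen ε k v.length (j + 1) : ℕ) : ℝ) ≤ c := by exact_mod_cast by omega
      have : 0 ≤ ε * k := by positivity
      linarith
    · have h3 := blockSize_le_of_ne_one h0.le hb
      have h4 : ((min (prefixLen ε k v.length j) k : ℕ) : ℝ) ≤ k := by
        exact_mod_cast min_le_right _ _
      have h5 := mul_le_mul_of_nonneg_left h4 h0.le
      have h6 : ((prefixLen ε k v.length (j + 1) : ℕ) : ℝ) ≤ prefixLen ε k v.length j +
        blockSize ε k (prefixLen ε k v.length j) := by exact_mod_cast hle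
      have h7 : ((prefixLen ε k v.length j : ℕ) : ℝ) ≤ c := by exact_mod_cast hjc.le
      linarith
  · intro hc0
    have : i0 = 0 := Nat.le_zero.mp (Nat.find_min' hex (by rw [hc0]; exact Nat.zero_le _))
    rw [this, prefixLen]
  · suffices h : ∀ j, i0 ≤ j → j ≤ i →
        ((prefixLen ε k v.length j : ℝ) - prefixLen ε k v.length i0) *
          ((1 - ε) * f (extendBy A v c) / k) ≤
        f (extendBy A v (prefixLen ε k v.length j)) -
          f (extendBy A v (prefixLen ε k v.length i0)) from h i hi0 le_rfl
    intro j hj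
    induction j, hj using Nat.le_induction with
    | base => intro _; simp
    | succ j hj ih =>
      intro hji
      have ih := ih (by omega)
      have hmono := prefixLen_mono ε k v.length (Nat.le_add_right j 1)
      have hcj := hspec.trans (prefixLen_mono ε k v.length hj)
      -- Empty blocks arise once the ordering is exhausted. For a nonempty one, `λ_{j+1} > c`, which
      -- gives the strict inequality required by `EndsInGoodRun`.
      rcases hmono.eq_or_lt with h | h
      · rw [← h]; exact ih
      have hb := hi j (by omega) (by omega)
      rw [BlockGood] at hb
      have h3 : (1 - ε) * f (extendBy A v c) / k ≤
          (1 - ε) * f (extendBy A v (prefixLen ε k v.length j)) / k := by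
        have := hm (extendBy_mono A v hcj)
        have : 0 ≤ 1 - ε := by linarith
        gcongr
      have h4 : (0 : ℝ) ≤ (prefixLen ε k v.length (j + 1) : ℝ) - prefixLen ε k v.length j := by
        have : ((prefixLen ε k v.length j : ℕ) : ℝ) ≤ prefixLen ε k v.length (j + 1) := by
          exact_mod_cast hmono
        linarith
      have h5 := mul_le_mul_of_nonneg_left h3 h4
      linarith

/-- Up to a loss of `2εk` elements, a fraction `1 / (1 + ε)` of the last at most `k` elements of `A`
have average marginal gain at least `(1 - ε) / k` times the value before them. -/
def WindowGain (f : Finset V → ℝ) (ε : ℝ) (k : ℕ) (A : List V) : Prop :=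
  ∀ c, 1 ≤ c → c ≤ A.length → A.length ≤ c + k →
    ((A.length : ℝ) - c - 2 * ε * k) / (1 + ε) * ((1 - ε) * f (A.take c).toFinset / k) ≤
      f A.toFinset - f (A.take c).toFinset

theorem toFinset_take_subset (A : List V) (c : ℕ) : (A.take c).toFinset ⊆ A.toFinset := by
  intro x hx
  rw [List.mem_toFinset] at hx ⊢
  exact List.mem_of_mem_take hx

/-- If `c` lies in the old part, the new part has at most `k` elements and all blocks up to `e` are
good; the extension past `e` costs the factor `1 + ε`, as `L ≤ (1+ε)e`. If `c` lies in the new part,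
at most `εk` elements are lost in the block around `c` and `εk` in the extension past `e`. -/
theorem WindowGain.append (hf0 : ∀ S, 0 ≤ f S) (hm : Monotone f) {ε : ℝ}
    (h0 : 0 < ε) (h1 : ε < 1 / 2) {k : ℕ} {A : List V} (hA : WindowGain f ε k A) (v : List V) :
    WindowGain f ε k (A ++ v.take (chosenLen f ε k A v)) := by
  classical
  obtain ⟨i, hi, hL⟩ : ∃ i, EndsInGoodRun f ε k A v i ∧ chosenLen f ε k A v =
      min v.length (prefixLen ε k v.length i + ⌊ε * (min (prefixLen ε k v.length i) k : ℕ)⌋₊) :=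
    ⟨Nat.findGreatest (EndsInGoodRun f ε k A v) v.length,
      Nat.findGreatest_spec (P := EndsInGoodRun f ε k A v) (Nat.zero_le _)
        (fun j hj => absurd hj (Nat.not_lt_zero j)), rfl⟩
  set L := chosenLen f ε k A v with hLdef
  set e := prefixLen ε k v.length i with he
  have hLs : L ≤ v.length := by rw [hL]; exact min_le_left _ _
  have heL : e ≤ L := by
    rw [hL]; exact le_min (prefixLen_le _ _ _ _) (Nat.le_add_right _ _)
  have hLe : (L : ℝ) ≤ e + ε * (min e k : ℕ) := by
    have h2 : L ≤ e + ⌊ε * (min e k : ℕ)⌋₊ := by rw [hL]; exact min_le_right _ _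
    have h3 : (L : ℝ) ≤ e + ⌊ε * (min e k : ℕ)⌋₊ := by exact_mod_cast h2
    have h4 := Nat.floor_le (show 0 ≤ ε * ((min e k : ℕ) : ℝ) by positivity)
    linarith
  have hlen : (A ++ v.take L).length = A.length + L := by
    rw [List.length_append, List.length_take, min_eq_left hLs]
  intro c hc1 hc2 hc3
  rw [hlen] at hc2 hc3 ⊢
  change _ ≤ f (extendBy A v L) - _
  rcases le_or_gt c A.length with hcA | hcA
  · have e1 : (A ++ v.take L).take c = A.take c := by
      rw [List.take_append_of_le_length hcA]
    rw [e1]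
    have hold := hA c hc1 hcA (by omega)
    obtain ⟨l, -, -, hl0, hl⟩ := exists_gain_of_endsInGoodRun hm h0 h1 (c := 0) hi
      (Nat.zero_le _) (by omega)
    rw [hl0 rfl, extendBy_zero, ← he, Nat.cast_zero, sub_zero] at hl
    have hmL := hm (extendBy_mono A v heL)
    have hmc := hm (toFinset_take_subset A c)
    have hLe2 : (L : ℝ) / (1 + ε) ≤ e := by
      rw [div_le_iff₀ (by linarith)]
      have : ((min e k : ℕ) : ℝ) ≤ e := by exact_mod_cast min_le_left _ _
      nlinarith
    have h5 : (1 - ε) * f (A.take c).toFinset / k ≤ (1 - ε) * f A.toFinset / k := by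
      have : 0 ≤ 1 - ε := by linarith
      gcongr
    have h6 : 0 ≤ (1 - ε) * f (A.take c).toFinset / k :=
      div_nonneg (mul_nonneg (by linarith) (hf0 _)) (by positivity)
    have h7 : (L : ℝ) / (1 + ε) * ((1 - ε) * f (A.take c).toFinset / k) ≤
        e * ((1 - ε) * f A.toFinset / k) := mul_le_mul hLe2 h5 h6 (by positivity)
    push_cast
    have e2 : ((A.length : ℝ) + L - c - 2 * ε * k) / (1 + ε) =
      ((A.length : ℝ) - c - 2 * ε * k) / (1 + ε) + L / (1 + ε) := by ring
    rw [e2, add_mul]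
    linarith
  · obtain ⟨d, rfl⟩ := Nat.exists_eq_add_of_le hcA.le
    have hdL : d ≤ L := by omega
    have e1 : (A ++ v.take L).take (A.length + d) = A ++ v.take d := by
      rw [List.take_length_add_append, List.take_take, min_eq_left hdL]
    rw [e1]
    change _ * ((1 - ε) * f (extendBy A v d) / k) ≤ _ - f (extendBy A v d)
    have h6 : 0 ≤ (1 - ε) * f (extendBy A v d) / k :=
      div_nonneg (mul_nonneg (by linarith) (hf0 _)) (by positivity)
    have hmd := hm (extendBy_mono A v hdL)
    push_cast
    have e2 : (A.length : ℝ) + L - (A.length + d) - 2 * ε * k = L - d - 2 * ε * k := by ring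
    rw [e2]
    have hLe3 : (L : ℝ) ≤ e + ε * k := by
      have h4 : ((min e k : ℕ) : ℝ) ≤ k := by exact_mod_cast min_le_right _ _
      have h5 := mul_le_mul_of_nonneg_left h4 h0.le
      linarith
    have hneg : (L : ℝ) - d - 2 * ε * k ≤ 0 →
        (L - d - 2 * ε * k) / (1 + ε) * ((1 - ε) * f (extendBy A v d) / k) ≤
        f (extendBy A v L) - f (extendBy A v d) := by
      intro h
      have : (L - d - 2 * ε * k) / (1 + ε) ≤ 0 := div_nonpos_of_nonpos_of_nonneg h (by linarith)
      have := mul_nonpos_of_nonpos_of_nonneg this h6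
      linarith
    rcases le_or_gt d e with hde | hde
    · obtain ⟨l, hl1, hl2, -, hl⟩ := exists_gain_of_endsInGoodRun hm h0 h1 (c := d) hi hde
        (by omega)
      rw [← he] at hl
      rcases le_or_gt ((L : ℝ) - d - 2 * ε * k) 0 with h | h
      · exact hneg h
      have hml := hm (extendBy_mono A v hl1)
      have hmL := hm (extendBy_mono A v heL)
      have h7 : ((L : ℝ) - d - 2 * ε * k) / (1 + ε) ≤ e - l := by
        refine (div_le_self h.le (by linarith)).trans ?_
        linarith
      have h8 := mul_le_mul_of_nonneg_right h7 h6
      linarith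
    · refine hneg ?_
      have : (e : ℝ) ≤ d := by exact_mod_cast hde.le
      have : 0 ≤ ε * k := by positivity
      linarith

/-- The last `k` elements of `A` have a constant fraction of its value. -/
theorem WindowGain.le_value_drop (hf0 : ∀ S, 0 ≤ f S) (hm : Monotone f)
    (hs : IsSubmodularFn f) {ε : ℝ} (h0 : 0 < ε) (h1 : ε < 1 / 2) {k : ℕ} (hk : 1 ≤ k)
    {A : List V} (hA : WindowGain f ε k A) :
    f A.toFinset ≤ 2 * (1 - ε + ε ^ 2) / ((1 - ε) * (1 - 2 * ε)) *
      f (A.drop (A.length - k)).toFinset := by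
  have hden : 0 < (1 - ε) * (1 - 2 * ε) := mul_pos (by linarith) (by linarith)
  have hk1 : (1 : ℝ) ≤ k := by exact_mod_cast hk
  rcases le_or_gt A.length k with h | h
  · rw [Nat.sub_eq_zero_of_le h, List.drop_zero]
    refine le_mul_of_one_le_left (hf0 _) ?_
    rw [le_div_iff₀ hden]
    nlinarith
  · have hw := hA (A.length - k) (by omega) (by omega) (by omega)
    set B := (A.take (A.length - k)).toFinset with hB
    set A' := (A.drop (A.length - k)).toFinset with hA'
    have hun : A' ∪ B = A.toFinset := by
      rw [Finset.union_comm, hB, hA', ← List.toFinset_append, List.take_append_drop]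
    have hsub := hs.marginalGain_le hm hf0 A' B
    rw [marginalGain, hun] at hsub
    have e1 : (A.length : ℝ) - ((A.length - k : ℕ) : ℝ) - 2 * ε * k = k * (1 - 2 * ε) := by
      rw [Nat.cast_sub h.le]; ring
    rw [e1] at hw
    have e2 : k * (1 - 2 * ε) / (1 + ε) * ((1 - ε) * f B / k) =
        (1 - ε) * (1 - 2 * ε) * f B / (1 + ε) := by
      field_simp
    rw [e2, div_le_iff₀ (by linarith)] at hw
    rw [div_mul_eq_mul_div, le_div_iff₀ hden]
    -- Split `f(A)` into `f(A) - f(B)` and `f(B)` and apply the window inequality to `f(B)`. The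
    -- coefficients add up to `2(1 - ε + ε²)`.
    have h5 : (1 - ε) * (1 - 2 * ε) * f A.toFinset ≤
        ((1 - ε) * (1 - 2 * ε) + (1 + ε)) * (f A.toFinset - f B) := by linarith
    have h6 := mul_le_mul_of_nonneg_left hsub
      (show 0 ≤ (1 - ε) * (1 - 2 * ε) + (1 + ε) by linarith)
    linarith

/-- The invariant of the loop on which the approximation guarantee rests. -/
structure LoopInvariant (f : Finset V → ℝ) (ε : ℝ) (k : ℕ) (Q : Finset V) (A : List V)
    (U : Finset V) : Prop where
  windowGain : WindowGain f ε k A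
  marginalGain_le : ∀ x ∈ Q, x ∉ U → marginalGain f {x} A.toFinset ≤ f A.toFinset / k

theorem LoopInvariant.filter (hf0 : ∀ S, 0 ≤ f S) {ε : ℝ} {k : ℕ} {Q : Finset V} {A : List V}
    {U : Finset V} (h : LoopInvariant f ε k Q A U) :
    LoopInvariant f ε k Q A (filterSet f k A U) := by
  refine ⟨h.windowGain, fun x hxQ hx => ?_⟩
  by_cases hxU : x ∈ U
  · rw [filterSet, Finset.mem_filter] at hx
    by_cases hxA : x ∈ A
    · rw [marginalGain_eq_zero_of_mem (List.mem_toFinset.mpr hxA)]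
      exact div_nonneg (hf0 _) (by positivity)
    · by_contra hlt
      exact hx ⟨hxU, hxA, (not_le.mp hlt).le⟩
  · exact h.marginalGain_le x hxQ hxU

theorem LoopInvariant.append (hf0 : ∀ S, 0 ≤ f S) (hm : Monotone f) (hs : IsSubmodularFn f)
    {ε : ℝ} (h0 : 0 < ε) (h1 : ε < 1 / 2) {k : ℕ} {Q : Finset V} {A : List V}
    {U : Finset V} (h : LoopInvariant f ε k Q A U) (v : List V) :
    LoopInvariant f ε k Q (A ++ v.take (chosenLen f ε k A v)) U := by
  refine ⟨h.windowGain.append hf0 hm h0 h1 v, fun x hxQ hxU => ?_⟩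
  have hsub : A.toFinset ⊆ (A ++ v.take (chosenLen f ε k A v)).toFinset := by
    rw [List.toFinset_append]; exact Finset.subset_union_left
  refine (hs.marginalGain_singleton_anti hm hsub x).trans
    ((h.marginalGain_le x hxQ hxU).trans ?_)
  have := hm hsub
  gcongr

/-- Split `O` along `U`: `f(O) ≤ f(U) + f(O \ U ∣ A) + f(A)`, where the middle term is at most `k ·
f(A)/k`. With `f(A) ≤ R f(A')` the ratio is `1 + 2R`. -/
theorem LoopInvariant.approx (hf0 : ∀ S, 0 ≤ f S) (hm : Monotone f) (hs : IsSubmodularFn f)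
    {ε : ℝ} (h0 : 0 < ε) (h1 : ε < 1 / 2) {k : ℕ} (hk : 1 ≤ k) {Q : Finset V} {A : List V}
    {U : Finset V} (h : LoopInvariant f ε k Q A U) (O : Finset V) (hOQ : O ⊆ Q)
    (hO : O.card ≤ k) :
    (5 + 4 * (2 - ε) * ε / ((1 - ε) * (1 - 2 * ε)))⁻¹ * f O ≤
      f (if f U ≤ f (A.drop (A.length - k)).toFinset
          then (A.drop (A.length - k)).toFinset else U) := by
  have hden : 0 < (1 - ε) * (1 - 2 * ε) := mul_pos (by linarith) (by linarith)
  have hk1 : (1 : ℝ) ≤ k := by exact_mod_cast hk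
  set A' := (A.drop (A.length - k)).toFinset with hA'
  set T := if f U ≤ f A' then A' else U with hT
  have hTU : f U ≤ f T := by rw [hT]; split_ifs with h <;> [exact h; exact le_rfl]
  have hTA : f A' ≤ f T := by
    rw [hT]; split_ifs with h <;> [exact le_rfl; exact (not_le.mp h).le]
  have hAA' := h.windowGain.le_value_drop hf0 hm hs h0 h1 hk
  rw [← hA'] at hAA'
  set R := 2 * (1 - ε + ε ^ 2) / ((1 - ε) * (1 - 2 * ε)) with hR
  have hR0 : 0 ≤ R := div_nonneg (by nlinarith) hden.le
  have eR : 5 + 4 * (2 - ε) * ε / ((1 - ε) * (1 - 2 * ε)) = 1 + 2 * R := by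
    have ha : 1 - ε ≠ 0 := by linarith
    have hb : 1 - 2 * ε ≠ 0 := by linarith
    rw [hR]; field_simp; ring
  have h2 : marginalGain f (O \ U) A.toFinset ≤ f A.toFinset := by
    refine (hs.marginalGain_le_sum hm _ _).trans ?_
    have h3 : ∑ x ∈ O \ U, marginalGain f {x} A.toFinset ≤
        ∑ x ∈ O \ U, f A.toFinset / k := Finset.sum_le_sum fun x hx => by
      rw [Finset.mem_sdiff] at hx
      exact h.marginalGain_le x (hOQ hx.1) hx.2
    refine h3.trans ?_
    rw [Finset.sum_const, nsmul_eq_mul]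
    have h4 : ((O \ U).card : ℝ) ≤ k := by
      exact_mod_cast (Finset.card_le_card Finset.sdiff_subset).trans hO
    calc _ ≤ (k : ℝ) * (f A.toFinset / k) :=
          mul_le_mul_of_nonneg_right h4 (div_nonneg (hf0 _) (by linarith))
      _ = _ := by field_simp
  have h3 := hs.marginalGain_le hm hf0 U ((O \ U) ∪ A.toFinset)
  have h4 : f O ≤ f (U ∪ ((O \ U) ∪ A.toFinset)) := hm (by
    intro x hx
    simp only [Finset.mem_union, Finset.mem_sdiff]
    tauto)
  rw [marginalGain] at h2 h3
  rw [eR, inv_mul_le_iff₀ (by linarith)]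
  have h5 := mul_le_mul_of_nonneg_left hTA hR0
  linarith

/-! ### Restriction to the elements of largest value -/

/-- The losses `f(x) - f(x ∣ S)` are non-negative with sum at most `p f(S)`, and `Q \ S` has at
least `pk/(1-α)` elements; some loss is at most the average. -/
theorem exists_small_loss [Fintype V] (hf0 : ∀ S, 0 ≤ f S) (hs : IsSubmodularFn f)
    (hm : Monotone f) {p α : ℝ} {k : ℕ} (hk : 1 ≤ k) (hp : 1 ≤ p)
    (hsup : IsSuperseparable f p) (hα1 : α < 1)
    {Q S : Finset V} (hQ : p * k / (1 - α) + k ≤ Q.card) (hS : S.card ≤ k) :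
    ∃ x ∈ Q \ S, f {x} - marginalGain f {x} S ≤ (1 - α) / k * f S := by
  have hk1 : (1 : ℝ) ≤ k := by exact_mod_cast hk
  have hα : 0 < 1 - α := by linarith
  have hcard : p * k / (1 - α) ≤ (Q \ S).card := by
    have h2 : Q.card ≤ (Q \ S).card + S.card := by
      have := Finset.le_card_sdiff S Q
      omega
    have h3 : (Q.card : ℝ) ≤ (Q \ S).card + S.card := by exact_mod_cast h2
    have h4 : (S.card : ℝ) ≤ k := by exact_mod_cast hS
    linarith
  have hpos : 0 < p * k / (1 - α) := by positivity
  have hne : (Q \ S).Nonempty := by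
    rw [← Finset.card_pos]
    have : (0 : ℝ) < (Q \ S).card := by linarith
    exact_mod_cast this
  by_contra hcon
  push Not at hcon
  have h2 := Finset.sum_lt_sum_of_nonempty hne hcon
  rw [Finset.sum_const, nsmul_eq_mul] at h2
  have h3 : ∑ x ∈ Q \ S, (f {x} - marginalGain f {x} S) ≤
      ∑ x, (f {x} - marginalGain f {x} S) :=
    Finset.sum_le_sum_of_subset_of_nonneg (Finset.subset_univ _) fun x _ _ => by
      linarith [hs.marginalGain_le hm hf0 {x} S]
  simp only [Finset.sum_sub_distrib] at h2 h3
  have h4 := hsup S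
  have h5 : p * f S ≤ (Q \ S).card * ((1 - α) / k * f S) := by
    have h6 : 0 ≤ (1 - α) / k * f S := mul_nonneg (by positivity) (hf0 S)
    refine le_trans (le_of_eq ?_) (mul_le_mul_of_nonneg_right hcard h6)
    field_simp
  linarith

/-- Superseparable functions are nearly maximized by elements of largest value. -/
theorem exists_subset_topSet [Fintype V] (hf0 : ∀ S, 0 ≤ f S) (hs : IsSubmodularFn f)
    (hm : Monotone f) {p α : ℝ} {k : ℕ} (hk : 1 ≤ k) (hp : 1 ≤ p)
    (hsup : IsSuperseparable f p) (hα0 : 0 < α) (hα1 : α < 1)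
    {Q : Finset V} (hQ : IsTopSet f ⌈p * k / (1 - α) + k⌉₊ Q) (O : Finset V) (hO : O.card ≤ k) :
    ∃ S ⊆ Q, S.card ≤ k ∧ α * f O ≤ f S := by
  have hk1 : (1 : ℝ) ≤ k := by exact_mod_cast hk
  rcases le_or_gt (Fintype.card V) ⌈p * k / (1 - α) + k⌉₊ with hn | hn
  · have hQu : Q = Finset.univ := by
      rw [← Finset.card_eq_iff_eq_univ, hQ.1, min_eq_right hn]
    refine ⟨O, by rw [hQu]; exact Finset.subset_univ _, hO, ?_⟩
    nlinarith [hf0 O]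
  have hQc : p * k / (1 - α) + k ≤ Q.card := by
    rw [hQ.1, min_eq_left hn.le]
    exact Nat.le_ceil _
  set c := (1 - α) / k with hc
  have hc0 : 0 ≤ c := div_nonneg (by linarith) (by linarith)
  -- Exchange argument: each `o ∈ R` is replaced by some `x ∈ Q` with `f(x) ≥ f(o)` and small loss.
  -- The cardinality bound keeps `S` small enough for the next exchange.
  have key : ∀ R ⊆ O \ Q, ∃ S ⊆ Q, S.card ≤ (O ∩ Q).card + R.card ∧
      f (O ∩ Q) + ∑ o ∈ R, f {o} ≤ f S + R.card * (c * f S) := by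
    intro R
    induction R using Finset.induction_on with
    | empty =>
      intro _
      exact ⟨O ∩ Q, Finset.inter_subset_right, by simp, by simp⟩
    | insert o R ho ih =>
      intro hR
      obtain ⟨S, hSQ, hSc, hSf⟩ := ih ((Finset.subset_insert _ _).trans hR)
      have hoQ : o ∉ Q := (Finset.mem_sdiff.mp (hR (Finset.mem_insert_self _ _))).2
      have hcard : (O ∩ Q).card + (insert o R).card ≤ k := by
        refine le_trans ?_ hO
        rw [← Finset.card_inter_add_card_sdiff O Q]
        exact Nat.add_le_add_left (Finset.card_le_card hR) _
      rw [Finset.card_insert_of_notMem ho] at hcard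
      obtain ⟨x, hx, hxf⟩ := exists_small_loss hf0 hs hm hk hp hsup hα1 hQc
        (S := S) (by omega)
      rw [Finset.mem_sdiff] at hx
      refine ⟨insert x S, Finset.insert_subset hx.1 hSQ, ?_, ?_⟩
      · rw [Finset.card_insert_of_notMem ho, Finset.card_insert_of_notMem hx.2]
        omega
      · rw [Finset.sum_insert ho, Finset.card_insert_of_notMem ho]
        have h2 := hQ.2 x hx.1 o hoQ
        have h3 : marginalGain f {x} S = f (insert x S) - f S := by
          rw [marginalGain, Finset.insert_eq]
        have h4 : f S ≤ f (insert x S) := hm (Finset.subset_insert _ _)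
        have h5 : ((R.card : ℝ) + 1) * (c * f S) ≤ (R.card + 1) * (c * f (insert x S)) := by
          gcongr
        push_cast
        linarith
  obtain ⟨S, hSQ, hSc, hSf⟩ := key (O \ Q) Finset.Subset.rfl
  rw [Finset.card_inter_add_card_sdiff] at hSc
  refine ⟨S, hSQ, hSc.trans hO, ?_⟩
  have h2 : f O ≤ f (O ∩ Q) + ∑ o ∈ O \ Q, f {o} := by
    have h3 := hs.marginalGain_le_sum hm (O \ Q) (O ∩ Q)
    have h4 : ∑ o ∈ O \ Q, marginalGain f {o} (O ∩ Q) ≤ ∑ o ∈ O \ Q, f {o} :=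
      Finset.sum_le_sum fun o _ => hs.marginalGain_le hm hf0 _ _
    rw [marginalGain, Finset.sdiff_union_inter] at h3
    linarith
  have h3 : ((O \ Q).card : ℝ) * (c * f S) ≤ (1 - α) * f S := by
    have h4 : ((O \ Q).card : ℝ) ≤ k := by
      exact_mod_cast (Finset.card_le_card Finset.sdiff_subset).trans hO
    calc _ ≤ (k : ℝ) * (c * f S) :=
          mul_le_mul_of_nonneg_right h4 (mul_nonneg hc0 (hf0 S))
      _ = _ := by rw [hc]; field_simp
  -- The conclusion follows from `α(2-α) = 1 - (1-α)² ≤ 1`.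
  have h4 : f O ≤ (2 - α) * f S := by linarith
  have h5 := mul_le_mul_of_nonneg_left h4 hα0.le
  have h6 := mul_nonneg (sq_nonneg (1 - α)) (hf0 S)
  linarith

end Approximation

/-! ### The whole procedure -/

noncomputable section Main

open scoped ENNReal

variable {V : Type*} {f : Finset V → ℝ}

theorem card_topSet_bounds [Fintype V] {p α : ℝ} {k : ℕ} (hk : 1 ≤ k) (hp : 1 ≤ p)
    (hα0 : 0 < α) (hα1 : α < 1) {Q : Finset V}
    (hQ : IsTopSet f ⌈p * k / (1 - α) + k⌉₊ Q) :
    (Q.card : ℝ) ≤ 3 * (p / (1 - α)) * k ∧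
      (k : ℝ) / Q.card ≤ max ((1 - α) / p) ((k : ℝ) / Fintype.card V) := by
  have hk1 : (1 : ℝ) ≤ k := by exact_mod_cast hk
  have hα : 0 < 1 - α := by linarith
  have hX : 1 ≤ p / (1 - α) := by rw [le_div_iff₀ hα]; linarith
  have e : p * k / (1 - α) = p / (1 - α) * k := by ring
  constructor
  · have h2 : Q.card ≤ ⌈p * k / (1 - α) + k⌉₊ := by rw [hQ.1]; exact min_le_left _ _
    have h3 : (Q.card : ℝ) ≤ ⌈p * k / (1 - α) + k⌉₊ := by exact_mod_cast h2
    have h4 := Nat.ceil_lt_add_one (show 0 ≤ p * k / (1 - α) + k by positivity)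
    nlinarith
  · rcases le_total ⌈p * k / (1 - α) + k⌉₊ (Fintype.card V) with h | h
    · refine le_trans ?_ (le_max_left _ _)
      rw [hQ.1, min_eq_left h]
      have h4 := Nat.le_ceil (p * k / (1 - α) + k)
      have h5 : 0 < p * k / (1 - α) := by positivity
      calc (k : ℝ) / ⌈p * k / (1 - α) + k⌉₊ ≤ k / (p * k / (1 - α)) := by
            gcongr
            linarith
        _ = _ := by field_simp
    · rw [hQ.1, min_eq_right h]
      exact le_max_right _ _

variable [DecidableEq V]

/-- The loop starts with a most valuable element of `Q`, if there is one. -/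
theorem exists_run_lowAdapLinearSeq (f : Finset V → ℝ) (Q : Finset V) (k : ℕ) (ε : ℝ) :
    ∃ A : List V, A.length ≤ 1 ∧ SingletonsLE f A Q ∧
      (lowAdapLinearSeq Q k ε).run f =
        ((lowAdapLoop k ε (lasIterations Q.card k ε) A Q).run f).map
          (RunOutcome.addRound (Q.image fun x => ({x} : Finset V)).card) := by
  refine ⟨_, ?_, ?_, rfl⟩
  · have h : ∀ o : Option V, o.toList.length ≤ 1 := fun o => by cases o <;> simp
    exact h _
  · intro x hx
    set g : V → ℝ := fun x =>
      (fun S => if S ∈ Q.image (fun x => ({x} : Finset V)) then f S else 0) {x} with hg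
    have hgf : ∀ y ∈ Q, g y = f {y} := fun y hy => by
      rw [hg]
      exact if_pos (Finset.mem_image_of_mem _ hy)
    have hxl : x ∈ Q.toList := Finset.mem_toList.mpr hx
    obtain ⟨a, ha⟩ : ∃ a, Q.toList.argmax g = some a := by
      rw [← Option.isSome_iff_exists, Option.isSome_iff_ne_none, Ne, List.argmax_eq_none]
      exact List.ne_nil_of_mem hxl
    have haQ : a ∈ Q := Finset.mem_toList.mp (List.argmax_mem ha)
    have hle := List.le_of_mem_argmax hxl ha
    rw [hgf x hx, hgf a haQ] at hle
    rw [ha]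
    simpa using hle

/-- The initial element belongs to no good block. It does no harm because `WindowGain` asks for `c ≥
1`: only `c = A.length` remains, where the required gain is not positive. -/
theorem loopInvariant_of_length_le_one (hf0 : ∀ S, 0 ≤ f S) {ε : ℝ} (h0 : 0 < ε)
    (h1 : ε < 1 / 2) {k : ℕ} {A : List V} (hA : A.length ≤ 1) (Q : Finset V) :
    LoopInvariant f ε k Q A Q := by
  refine ⟨fun c hc1 hc2 _ => ?_, fun x hx hx' => absurd hx hx'⟩
  obtain rfl : c = A.length := by omega
  rw [List.take_length, sub_self, sub_self, zero_sub]
  refine mul_nonpos_of_nonpos_of_nonneg ?_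
    (div_nonneg (mul_nonneg (by linarith) (hf0 _)) (by positivity))
  exact div_nonpos_of_nonpos_of_nonneg (by simp only [neg_nonpos]; positivity) (by linarith)

theorem lasIterations_eq_zero {n k : ℕ} {ε : ℝ} (h0 : 0 < ε) (h1 : ε < 1 / 2) (h : n ≤ k) :
    lasIterations n k ε = 0 := by
  have hβ := lasBeta_pos h0 h1
  rw [lasIterations, Nat.ceil_eq_zero]
  refine mul_nonpos_of_nonneg_of_nonpos (by positivity) ?_
  refine Real.log_nonpos (by positivity) (div_le_one_of_le₀ ?_ (by positivity))
  exact_mod_cast h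

/-- The iterations suffice to reduce `n` candidates to `k`. -/
theorem contraction_pow_le {n k : ℕ} {ε : ℝ} (h0 : 0 < ε) (h1 : ε < 1 / 2) (hk : 1 ≤ k)
    (h : k < n) :
    ∃ i, lasIterations n k ε = i + 1 ∧
      (1 - lasBeta ε * ε / 2) ^ i * n / k ≤ 2 * (k / n) := by
  have hβ := lasBeta_pos h0 h1
  have hρ := half_le_contractionFactor h0 h1
  have hk1 : (1 : ℝ) ≤ k := by exact_mod_cast hk
  have hn : (k : ℝ) < n := by exact_mod_cast h
  have hq : 1 < (n : ℝ) / k := by rw [lt_div_iff₀ (by linarith)]; linarith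
  have hlog := Real.log_pos hq
  have hpos : 0 < lasIterations n k ε := by
    rw [lasIterations, Nat.ceil_pos]; positivity
  obtain ⟨i, hi⟩ : ∃ i, lasIterations n k ε = i + 1 := ⟨lasIterations n k ε - 1, by omega⟩
  refine ⟨i, hi, ?_⟩
  have hge : 4 * (1 + 1 / (lasBeta ε * ε)) * Real.log ((n : ℝ) / k) ≤ (i + 1 : ℕ) := by
    rw [← hi]; exact Nat.le_ceil _
  set γ := lasBeta ε * ε with hγ
  have hγ0 : 0 < γ := by positivity
  have h2 : 2 * Real.log ((n : ℝ) / k) ≤ (i + 1 : ℕ) * (γ / 2) := by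
    have h3 := mul_le_mul_of_nonneg_right hge (show 0 ≤ γ / 2 by positivity)
    have e : 4 * (1 + 1 / γ) * Real.log ((n : ℝ) / k) * (γ / 2) =
      2 * Real.log ((n : ℝ) / k) + 2 * γ * Real.log ((n : ℝ) / k) := by
      field_simp; ring
    have h4 : 0 ≤ 2 * γ * Real.log ((n : ℝ) / k) := by positivity
    linarith
  -- The square is needed: one factor `k/n` cancels the initial ratio `n/k`, the other one is the
  -- failure probability.
  have h5 : (1 - γ / 2) ^ (i + 1) ≤ (k / n) ^ 2 := by
    calc (1 - γ / 2) ^ (i + 1) ≤ Real.exp (-(γ / 2)) ^ (i + 1) := by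
          refine pow_le_pow_left₀ (by linarith) ?_ _
          have := Real.add_one_le_exp (-(γ / 2))
          linarith
      _ = Real.exp (-((i + 1 : ℕ) * (γ / 2))) := by rw [← Real.exp_nat_mul]; ring_nf
      _ ≤ Real.exp (-(2 * Real.log ((n : ℝ) / k))) := Real.exp_le_exp.mpr (by linarith)
      _ = _ := by
          rw [Real.exp_neg, show 2 * Real.log ((n : ℝ) / k) = ((2 : ℕ) : ℝ) *
            Real.log ((n : ℝ) / k) by norm_num, Real.exp_nat_mul,
            Real.exp_log (by linarith), ← inv_pow, inv_div]
  have h6 : (1 - γ / 2) ^ i ≤ 2 * (k / n) ^ 2 := by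
    rw [pow_succ] at h5
    have h7 : 0 ≤ (1 - γ / 2) ^ i := pow_nonneg (by linarith) _
    nlinarith
  have hn0 : (0 : ℝ) < n := by linarith
  calc (1 - γ / 2) ^ i * n / k ≤ 2 * (k / n) ^ 2 * n / k := by gcongr
    _ = 2 * (k / n) := by field_simp

theorem expect_failure_lowAdapLinearSeq_le (hf0 : ∀ S, 0 ≤ f S) (hm : Monotone f)
    (hs : IsSubmodularFn f) {ε : ℝ} (h0 : 0 < ε) (h1 : ε < 1 / 2) {k : ℕ} (hk : 1 ≤ k)
    {A : List V} {Q : Finset V} (hA : SingletonsLE f A Q) :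
    ((lowAdapLoop k ε (lasIterations Q.card k ε) A Q).run f).expect
        (Set.indicator {x | x.output = none} 1) ≤ ENNReal.ofReal (2 * (k / Q.card)) := by
  rcases le_or_gt Q.card k with h | h
  · rw [lasIterations_eq_zero h0 h1 h, run_lowAdapLoop_zero, if_pos h, run_returnBest,
      PMF.expect_pure]
    simp
  · obtain ⟨i, hi, hle⟩ := contraction_pow_le h0 h1 hk h
    rw [hi]
    refine (expect_failure_le hf0 hm hs h0 h1 hk i A Q hA).trans (ENNReal.ofReal_le_ofReal ?_)
    refine le_trans ?_ hle
    have h2 : ((filterSet f k A Q).card : ℝ) ≤ Q.card := by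
      exact_mod_cast Finset.card_le_card (Finset.filter_subset _ _)
    have := half_le_contractionFactor h0 h1
    have : 0 ≤ 1 - lasBeta ε * ε / 2 := by linarith
    gcongr

theorem inv_lasBeta_mul_le {ε : ℝ} (h0 : 0 < ε) (h1 : ε < 1 / 2) :
    1 / (lasBeta ε * ε) ≤ 512 / ε ^ 3 := by
  have hβ := lasBeta_pos h0 h1
  have h := le_lasBeta h0 h1
  rw [div_le_div_iff₀ (by positivity) (by positivity)]
  nlinarith [mul_le_mul_of_nonneg_right h h0.le]

theorem one_le_inv_pow {ε : ℝ} (h0 : 0 < ε) (h1 : ε < 1 / 2) (n : ℕ) : 1 ≤ 1 / ε ^ n := by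
  rw [le_div_iff₀ (by positivity), one_mul]
  exact pow_le_one₀ h0.le (by linarith)

theorem lasIterations_le {n k : ℕ} {ε X : ℝ} (h0 : 0 < ε) (h1 : ε < 1 / 2) (hk : 1 ≤ k)
    (hX : 1 ≤ X) (hn : (n : ℝ) ≤ 3 * X * k) :
    (lasIterations n k ε : ℝ) ≤ 4105 * (1 / ε ^ 3 * (1 + Real.log X)) := by
  have hk1 : (1 : ℝ) ≤ k := by exact_mod_cast hk
  have hlogX := Real.log_nonneg hX
  have hβ := lasBeta_pos h0 h1
  have hε := one_le_inv_pow h0 h1 3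
  have hinv := inv_lasBeta_mul_le h0 h1
  have hlog : Real.log ((n : ℝ) / k) ≤ 2 + Real.log X := by
    rcases Nat.eq_zero_or_pos n with h | h
    · rw [h]; simp; linarith
    · have h2 : (n : ℝ) / k ≤ 3 * X := by rw [div_le_iff₀ (by linarith)]; exact hn
      have hn0 : (0 : ℝ) < n := by exact_mod_cast h
      have h3 := Real.log_le_log (by positivity) h2
      rw [Real.log_mul (by norm_num) (by linarith)] at h3
      have := Real.log_le_sub_one_of_pos (show (0 : ℝ) < 3 by norm_num)
      linarith
  have hcoef : 4 * (1 + 1 / (lasBeta ε * ε)) ≤ 2052 * (1 / ε ^ 3) := by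
    have e : 512 / ε ^ 3 = 512 * (1 / ε ^ 3) := by ring
    linarith
  have h2 : 4 * (1 + 1 / (lasBeta ε * ε)) * Real.log ((n : ℝ) / k) ≤
      2052 * (1 / ε ^ 3) * (2 + Real.log X) := by
    refine (mul_le_mul_of_nonneg_left hlog (by positivity)).trans ?_
    exact mul_le_mul_of_nonneg_right hcoef (by linarith)
  have h3 : (lasIterations n k ε : ℝ) ≤ 2052 * (1 / ε ^ 3) * (2 + Real.log X) + 1 := by
    rw [lasIterations]
    have h4 : (0 : ℝ) ≤ 2052 * (1 / ε ^ 3) * (2 + Real.log X) := by positivity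
    exact (Nat.cast_le.mpr (Nat.ceil_le_ceil h2)).trans (Nat.ceil_lt_add_one h4).le
  have h5 : 0 ≤ 1 / ε ^ 3 * Real.log X := by positivity
  linarith

end Main

theorem mainTheorem4 :
    ∃ C : ℝ, 0 < C ∧
      ∀ (V : Type*) [Fintype V] [DecidableEq V] (f : Finset V → ℝ) (p α ε : ℝ) (k : ℕ)
        (Q : Finset V),
        (∀ S, 0 ≤ f S) → Monotone f → IsSubmodularFn f → IsSuperseparable f p →
        1 ≤ p → 1 ≤ k → 0 < α → α < 1 → 0 < ε → ε < 1 / 2 →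
        IsTopSet f ⌈p * k / (1 - α) + k⌉₊ Q →
        1 - C * max ((1 - α) / p) ((k : ℝ) / Fintype.card V) ≤
            (((lowAdapLinearSeq Q k ε).run f).toOuterMeasure
              {x | ∃ S : Finset V, x.output = some S ∧ S.card ≤ k ∧
                ∀ O : Finset V, O.card ≤ k →
                  α * (5 + 4 * (2 - ε) * ε / ((1 - ε) * (1 - 2 * ε)))⁻¹ * f O ≤ f S}).toReal ∧
          (∀ x ∈ ((lowAdapLinearSeq Q k ε).run f).support,
            (x.rounds : ℝ) ≤ C * (1 / ε ^ 3 * (1 + Real.log (p / (1 - α))))) ∧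
          expectedQueries ((lowAdapLinearSeq Q k ε).run f) ≤
            ENNReal.ofReal (C * (1 / (1 - α) * (p * k / ε ^ 3 + p / ε ^ 4))) := by
  -- The query count decides: the bounds below give `16420 + 6144 + 8 = 22572`. Rounds need `2 ·
  -- 4105 + 2`, and the failure probability needs 2.
  refine ⟨30000, by norm_num, ?_⟩
  intro V _ _ f p α ε k Q hf0 hm hs hsup hp hk hα0 hα1 h0 h1 hQ
  obtain ⟨A, hA1, hA, hrun⟩ := exists_run_lowAdapLinearSeq f Q k ε
  obtain ⟨hQ1, hQ2⟩ := card_topSet_bounds hk hp hα0 hα1 hQ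
  have hk1 : (1 : ℝ) ≤ k := by exact_mod_cast hk
  have hα : 0 < 1 - α := by linarith
  have hX : 1 ≤ p / (1 - α) := by rw [le_div_iff₀ hα]; linarith
  have hit := lasIterations_le h0 h1 hk hX hQ1
  have hlogX := Real.log_nonneg hX
  have hε3 := one_le_inv_pow h0 h1 3
  rw [hrun]
  set n := lasIterations Q.card k ε with hn
  refine ⟨?_, ?_, ?_⟩
  · set P := ((lowAdapLoop k ε n A Q).run f).map
      (RunOutcome.addRound (Q.image fun x => ({x} : Finset V)).card) with hP
    set G : Set (RunOutcome (Option (Finset V))) := {x | ∃ S : Finset V, x.output = some S ∧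
      S.card ≤ k ∧ ∀ O : Finset V, O.card ≤ k →
        α * (5 + 4 * (2 - ε) * ε / ((1 - ε) * (1 - 2 * ε)))⁻¹ * f O ≤ f S} with hG
    have hsplit := P.one_le_toOuterMeasure_add_expect G {x | x.output = none} (by
      intro x hx hxn
      rw [hP, PMF.mem_support_map_iff] at hx
      obtain ⟨y, hy, rfl⟩ := hx
      rcases output_of_mem_support_lowAdapLoop (LoopInvariant f ε k Q)
        (fun A U h => h.filter hf0) (fun A U v h _ => h.append hf0 hm hs h0 h1 v) n A Q
        (loopInvariant_of_length_le_one hf0 h0 h1 hA1 Q) y hy with h | ⟨A, U, hAU, hUk, h⟩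
      · exact absurd h hxn
      · refine ⟨_, h, ?_, fun O hO => ?_⟩
        · split_ifs
          · refine (List.toFinset_card_le _).trans ?_
            rw [List.length_drop]
            omega
          · exact hUk
        · obtain ⟨S, hSQ, hSk, hS⟩ := exists_subset_topSet hf0 hs hm hk hp hsup hα0 hα1 hQ O hO
          refine le_trans ?_ (hAU.approx hf0 hm hs h0 h1 hk S hSQ hSk)
          rw [mul_comm α, mul_assoc]
          refine mul_le_mul_of_nonneg_left hS (inv_nonneg.mpr ?_)
          have : 0 ≤ 4 * (2 - ε) * ε / ((1 - ε) * (1 - 2 * ε)) :=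
            div_nonneg (mul_nonneg (by linarith) h0.le)
              (mul_nonneg (by linarith) (by linarith))
          linarith)
    have hfail : P.expect (Set.indicator {x | x.output = none} 1) ≤
        ENNReal.ofReal (2 * (k / Q.card)) := by
      rw [hP, PMF.expect_map]
      exact expect_failure_lowAdapLinearSeq_le hf0 hm hs h0 h1 hk hA
    have hfin : P.toOuterMeasure G ≠ ⊤ := by
      refine ne_top_of_le_ne_top ENNReal.one_ne_top ?_
      rw [PMF.toOuterMeasure_apply, ← P.tsum_coe]
      exact ENNReal.tsum_le_tsum fun x => Set.indicator_le_self _ _ _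
    have h3 := hsplit.trans (add_le_add_right hfail _)
    rw [← ENNReal.ofReal_toReal hfin, ← ENNReal.ofReal_add ENNReal.toReal_nonneg
      (by positivity), ENNReal.one_le_ofReal] at h3
    have h4 : 0 ≤ max ((1 - α) / p) ((k : ℝ) / Fintype.card V) :=
      le_max_of_le_left (by positivity)
    linarith
  · intro x hx
    rw [PMF.mem_support_map_iff] at hx
    obtain ⟨y, hy, rfl⟩ := hx
    have h2 := rounds_lowAdapLoop_le f k ε n A Q y hy
    have h3 : (y.rounds : ℝ) ≤ 2 * n + 1 := by exact_mod_cast h2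
    change ((y.rounds + 1 : ℕ) : ℝ) ≤ _
    push_cast
    have h4 : 1 ≤ 1 / ε ^ 3 * (1 + Real.log (p / (1 - α))) := by nlinarith
    linarith
  · rw [expectedQueries_map_addRound]
    have hfirst : (((Q.image fun x => ({x} : Finset V)).card : ℕ) : ENNReal) ≤
        ENNReal.ofReal Q.card := by
      rw [ENNReal.ofReal_natCast]
      exact_mod_cast Finset.card_image_le
    refine (add_le_add (expectedQueries_lowAdapLoop_le hf0 hm hs h0 h1 hk n A Q hA)
      hfirst).trans ?_
    have hβ := lasBeta_pos h0 h1
    rw [← ENNReal.ofReal_add (by positivity) (by positivity)]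
    refine ENNReal.ofReal_le_ofReal ?_
    set X := p / (1 - α) with hXdef
    have e1 : 1 / (1 - α) * (p * k / ε ^ 3 + p / ε ^ 4) =
        X * k * (1 / ε ^ 3) + X * (1 / ε ^ 4) := by rw [hXdef]; ring
    rw [e1]
    have hXk : 1 ≤ X * k := by nlinarith
    have hY1 : X * k ≤ X * k * (1 / ε ^ 3) := le_mul_of_one_le_right (by linarith) hε3
    have hY2 : 0 ≤ X * (1 / ε ^ 4) := by positivity
    have hiter : (n : ℝ) * (k + 3) ≤ 16420 * (X * k * (1 / ε ^ 3)) := by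
      have h2 : 1 + Real.log X ≤ X := by
        have := Real.log_le_sub_one_of_pos (show 0 < X by linarith)
        linarith
      have h3 : (n : ℝ) ≤ 4105 * (1 / ε ^ 3 * X) :=
        hit.trans (by gcongr)
      calc (n : ℝ) * (k + 3) ≤ 4105 * (1 / ε ^ 3 * X) * (4 * k) := by
            gcongr
            linarith
        _ = _ := by ring
    have hmain : 2 * (1 + 2 / (ε * k)) / (lasBeta ε * ε) * (filterSet f k A Q).card ≤
        6144 * (X * k * (1 / ε ^ 3) + X * (1 / ε ^ 4)) := by
      have h2 : ((filterSet f k A Q).card : ℝ) ≤ 3 * X * k := le_trans (by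
        exact_mod_cast Finset.card_le_card (Finset.filter_subset _ _)) hQ1
      calc _ = 2 * (1 + 2 / (ε * k)) * (1 / (lasBeta ε * ε)) * (filterSet f k A Q).card := by
            ring
        _ ≤ 2 * (1 + 2 / (ε * k)) * (512 / ε ^ 3) * (3 * X * k) := by
            have := inv_lasBeta_mul_le h0 h1
            gcongr
        _ = 3072 * (X * k * (1 / ε ^ 3)) + 6144 * (X * (1 / ε ^ 4)) := by
            field_simp; ring
        _ ≤ _ := by linarith
    have hQ3 : (Q.card : ℝ) ≤ 3 * (X * k) := by linarith
    linarith
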